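/- Let $\Bbbk$ be a field; $\otimes$ is over $\Bbbk$ and all maps are $\Bbbk$-linear. A \emph{weak bialgebra} is a vector space $A$ with an associative unital algebra structure and a coassociative counital coalgebra structure $(\Delta,\varepsilon)$, $\Delta(x)=x_1\otimes x_2$, such that $\Delta(xy)=\Delta(x)\Delta(y)$, $\varepsilon(xyz)=\varepsilon(xy_1)\varepsilon(y_2z)=\varepsilon(xy_2)\varepsilon(y_1z)$ and $(1\otimes\Delta(1))(\Delta(1)\otimes 1)=(\Delta(1)\otimes 1)(1\otimes\Delta(1))=(I\otimes\Delta)\Delta(1)$. Put $\varepsilon_t(x)=\varepsilon(1_1x)1_2$, $\varepsilon_s(x)=1_1\varepsilon(x1_2)$ and $A_s=\varepsilon_s(A)$. A weak bialgebra is a \emph{weak Hopf algebra} if there is a linear map $S:A\to A$ (an antipode) with $x_1S(x_2)=\varepsilon_t(x)$, $S(x_1)x_2=\varepsilon_s(x)$ and $S(x_1)x_2S(x_3)=S(x)$ for all $x\in A$. Let $C$ and $H$ be weak Hopf algebras over $\Bbbk$ with antipodes $S_C$ and $S_H$, with $H$ commutative, and let $\rho:C\to H\otimes C$, $\rho(c)=c^{-1}\otimes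 c^{0}$, be a linear map making $C$ a left $H$-comodule bialgebra. This means that $\rho$ makes $C$ simultaneously (a) a left $H$-comodule coalgebra: for all $c\in C$, $\varepsilon_H(c^{-1})c^0=c$; $(I\otimes\rho)\rho(c)=(\Delta_H\otimes I)\rho(c)$; $c^{-1}\otimes (c^0)_1\otimes (c^0)_2=c_1{}^{-1}c_2{}^{-1}\otimes c_1{}^0\otimes c_2{}^0$; and $c^{-1}\varepsilon_C(c^0)=\varepsilon_t(c^{-1})\varepsilon_C(c^0)$; and (b) a left $H$-comodule algebra: $\rho(cd)=\rho(c)\rho(d)$ for all $c,d\in C$, and $\rho(1_C)\in H_s\otimes C$. For $c\in C$ and $h\in H$ put $c\times h=c^0\otimes h_2\,\varepsilon_H(c^{-1}h_1)\in C\otimes H$, and let the weak smash coproduct $C\times H\subseteq C\otimes H$ be the linear span of all the elements $c\times h$. Then $C\times H$ is a weak Hopf algebra, with unit $1_C\times 1_H$ and with product, coproduct, counit and antipode given (in particular well defined) by $$(c\times h)(b\times k)=cb\times hk,\qquad \Delta(c\times h)=(c_1\times c_2{}^{-1}h_1)\otimes(c_2{}^{0}\times h_2),$$ $$\varepsilon(c\times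 h)=\varepsilon_C(c^0)\,\varepsilon_H(c^{-1}h),\qquad S(c\times h)=S_C(c^0)\times S_H(c^{-1}h)$$ for all $c,b\in C$ and $h,k\in H$. -/

import Mathlib

open scoped TensorProduct

noncomputable section

namespace WeakHopf

universe u v w

section Structures

variable {k : Type u} {V : Type v} [Field k] [AddCommGroup V] [Module k V]

/-- The target map `ε_t(h) = ε(1₁ h) 1₂ = (ε ⊗ I)(Δ(1)(h ⊗ 1))`. Here `mul` is the product,
`e` the unit, `Δ` the coproduct and `ε` the counit on the vector space `V`. -/
def targetMap (mul : V →ₗ[k] V →ₗ[k] V) (e : V) (Δ : V →ₗ[k] V ⊗[k] V) (ε : V →ₗ[k] k) :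
    V →ₗ[k] V :=
  (TensorProduct.lid k V).toLinearMap ∘ₗ ε.rTensor V ∘ₗ
    TensorProduct.map₂ mul mul (Δ e) ∘ₗ (TensorProduct.mk k V V).flip e

/-- The source map `ε_s(h) = 1₁ ε(h 1₂) = (I ⊗ ε)((1 ⊗ h)Δ(1))`. -/
def sourceMap (mul : V →ₗ[k] V →ₗ[k] V) (e : V) (Δ : V →ₗ[k] V ⊗[k] V) (ε : V →ₗ[k] k) :
    V →ₗ[k] V :=
  (TensorProduct.rid k V).toLinearMap ∘ₗ ε.lTensor V ∘ₗ
    (TensorProduct.map₂ mul mul).flip (Δ e) ∘ₗ TensorProduct.mk k V V e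

/-- `(V, mul, e, Δ, ε)` is a weak bialgebra: an associative unital algebra and a coassociative
counital coalgebra such that `Δ` is multiplicative, `ε` is weakly multiplicative and the unit is
weakly comultiplicative. The product of `V ⊗ V` is `TensorProduct.map₂ mul mul`. -/
structure IsWeakBialgebra (mul : V →ₗ[k] V →ₗ[k] V) (e : V) (Δ : V →ₗ[k] V ⊗[k] V)
    (ε : V →ₗ[k] k) : Prop where
  mul_assoc : ∀ x y z, mul (mul x y) z = mul x (mul y z)
  one_mul : ∀ x, mul e x = x
  mul_one : ∀ x, mul x e = x
  coassoc : ∀ x, TensorProduct.assoc k V V V (Δ.rTensor V (Δ x)) = Δ.lTensor V (Δ x)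
  counit_left : ∀ x, TensorProduct.lid k V (ε.rTensor V (Δ x)) = x
  counit_right : ∀ x, TensorProduct.rid k V (ε.lTensor V (Δ x)) = x
  /-- `Δ(xy) = Δ(x)Δ(y)` -/
  comul_mul : ∀ x y, Δ (mul x y) = TensorProduct.map₂ mul mul (Δ x) (Δ y)
  /-- `ε(xyz) = ε(x y₁) ε(y₂ z)` -/
  counit_mul_left : ∀ x y z, ε (mul (mul x y) z) =
    LinearMap.mul' k k (TensorProduct.map (ε ∘ₗ mul x) (ε ∘ₗ mul.flip z) (Δ y))
  /-- `ε(xyz) = ε(x y₂) ε(y₁ z)` -/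
  counit_mul_right : ∀ x y z, ε (mul (mul x y) z) =
    LinearMap.mul' k k (TensorProduct.map (ε ∘ₗ mul.flip z) (ε ∘ₗ mul x) (Δ y))
  /-- `(1 ⊗ Δ(1))(Δ(1) ⊗ 1) = (I ⊗ Δ)Δ(1)` -/
  comul_one_left : TensorProduct.map₂ mul (TensorProduct.map₂ mul mul)
    (e ⊗ₜ[k] Δ e) (TensorProduct.assoc k V V V (Δ e ⊗ₜ[k] e)) = Δ.lTensor V (Δ e)
  /-- `(Δ(1) ⊗ 1)(1 ⊗ Δ(1)) = (I ⊗ Δ)Δ(1)` -/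
  comul_one_right : TensorProduct.map₂ mul (TensorProduct.map₂ mul mul)
    (TensorProduct.assoc k V V V (Δ e ⊗ₜ[k] e)) (e ⊗ₜ[k] Δ e) = Δ.lTensor V (Δ e)

/-- `(V, mul, e, Δ, ε)` is a weak bialgebra and `S` is an antipode for it, that is, `V` with these
operations is a weak Hopf algebra. -/
structure IsWeakHopfAlgebra (mul : V →ₗ[k] V →ₗ[k] V) (e : V) (Δ : V →ₗ[k] V ⊗[k] V)
    (ε : V →ₗ[k] k) (S : V →ₗ[k] V) : Prop extends IsWeakBialgebra mul e Δ ε where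
  /-- `h₁ S(h₂) = ε_t(h)` -/
  mul_antipode : ∀ h, TensorProduct.lift mul (S.lTensor V (Δ h)) = targetMap mul e Δ ε h
  /-- `S(h₁) h₂ = ε_s(h)` -/
  antipode_mul : ∀ h, TensorProduct.lift mul (S.rTensor V (Δ h)) = sourceMap mul e Δ ε h
  /-- `S(h₁) h₂ S(h₃) = S(h)` -/
  antipode_mul_antipode : ∀ h, TensorProduct.lift mul
    (TensorProduct.map (TensorProduct.lift mul ∘ₗ S.rTensor V ∘ₗ Δ) S (Δ h)) = S h

end Structures

section Comodules

variable {k : Type u} {C : Type v} {H : Type w} [Field k]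
variable [Ring H] [Algebra k H] [Coalgebra k H]

/-- `S` makes the algebra and coalgebra `H` into a weak Hopf algebra. -/
def IsAntipode (S : H →ₗ[k] H) : Prop :=
  IsWeakHopfAlgebra (LinearMap.mul k H) 1 (Coalgebra.comul (R := k) (A := H))
    (Coalgebra.counit (R := k) (A := H)) S

variable (k H) in
/-- The target map of `H`. -/
def εt : H →ₗ[k] H :=
  targetMap (LinearMap.mul k H) 1 (Coalgebra.comul (R := k) (A := H))
    (Coalgebra.counit (R := k) (A := H))

variable (k H) in
/-- The source map of `H`. -/
def εs : H →ₗ[k] H :=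
  sourceMap (LinearMap.mul k H) 1 (Coalgebra.comul (R := k) (A := H))
    (Coalgebra.counit (R := k) (A := H))

/-- `ρ(c) = c⁻¹ ⊗ c⁰` is a left `H`-comodule structure on the vector space `C`. -/
structure IsComodule [AddCommGroup C] [Module k C] (ρ : C →ₗ[k] H ⊗[k] C) : Prop where
  /-- `(ε_H ⊗ I)ρ(c) = c` -/
  counit_coact : ∀ c,
    TensorProduct.lid k C ((Coalgebra.counit (R := k) (A := H)).rTensor C (ρ c)) = c
  /-- `(I ⊗ ρ)ρ(c) = (Δ_H ⊗ I)ρ(c)` -/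
  coact_coact : ∀ c, ρ.lTensor H (ρ c) =
    TensorProduct.assoc k H H C ((Coalgebra.comul (R := k) (A := H)).rTensor C (ρ c))

/-- `ρ` makes the coalgebra `C` a left `H`-comodule coalgebra. -/
structure IsComoduleCoalgebra [AddCommGroup C] [Module k C] [Coalgebra k C]
    (ρ : C →ₗ[k] H ⊗[k] C) : Prop extends IsComodule ρ where
  /-- `c⁻¹ ⊗ (c⁰)₁ ⊗ (c⁰)₂ = c₁⁻¹ c₂⁻¹ ⊗ c₁⁰ ⊗ c₂⁰` -/
  comul_coact : ∀ c, (Coalgebra.comul (R := k) (A := C)).lTensor H (ρ c) =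
    (LinearMap.mul' k H).rTensor (C ⊗[k] C)
      (TensorProduct.tensorTensorTensorComm k H C H C
        (TensorProduct.map ρ ρ (Coalgebra.comul (R := k) c)))
  /-- `c⁻¹ ε_C(c⁰) = ε_t(c⁻¹) ε_C(c⁰)` -/
  coact_counit : ∀ c, (Coalgebra.counit (R := k) (A := C)).lTensor H (ρ c) =
    TensorProduct.map (εt k H) (Coalgebra.counit (R := k) (A := C)) (ρ c)

/-- `ρ` makes the algebra `C` a left `H`-comodule algebra: a comodule structure which is
multiplicative, with `ρ(1) ∈ H_s ⊗ C` (recall that `ε_s` is idempotent with image `H_s`). -/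
structure IsComoduleAlgebra [Ring C] [Algebra k C]
    (ρ : C →ₗ[k] H ⊗[k] C) : Prop extends IsComodule ρ where
  coact_mul : ∀ c d, ρ (c * d) = ρ c * ρ d
  coact_one : (εs k H).rTensor C (ρ 1) = ρ 1

/-- `ρ` makes `C` a left `H`-comodule bialgebra. -/
structure IsComoduleBialgebra [Ring C] [Algebra k C] [Coalgebra k C]
    (ρ : C →ₗ[k] H ⊗[k] C) : Prop where
  comoduleCoalgebra : IsComoduleCoalgebra ρ
  comoduleAlgebra : IsComoduleAlgebra ρ

end Comodules

section Smash

variable {k : Type u} {C : Type v} {H : Type w} [Field k]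
variable [Ring C] [Algebra k C] [Ring H] [Algebra k H] [Coalgebra k H]
variable (ρ : C →ₗ[k] H ⊗[k] C)

/-- The linear map `c ⊗ h ↦ c⁰ ⊗ h₂ ε_H(c⁻¹ h₁)`. -/
def smashMap : C ⊗[k] H →ₗ[k] C ⊗[k] H :=
  (TensorProduct.lid k (C ⊗[k] H)).toLinearMap ∘ₗ
    (Coalgebra.counit (R := k) (A := H) ∘ₗ LinearMap.mul' k H).rTensor (C ⊗[k] H) ∘ₗ
    (TensorProduct.tensorTensorTensorComm k H C H H).toLinearMap ∘ₗ
    TensorProduct.map ρ (Coalgebra.comul (R := k) (A := H))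

/-- The weak smash coproduct `C × H`: the subspace of `C ⊗ H` spanned by the elements
`c⁰ ⊗ h₂ ε_H(c⁻¹ h₁)`. -/
def smash : Submodule k (C ⊗[k] H) :=
  Submodule.span k (Set.range fun p : C × H => smashMap ρ (p.1 ⊗ₜ[k] p.2))

theorem smashMap_mem (x : C ⊗[k] H) : smashMap ρ x ∈ smash ρ := by
  induction x using TensorProduct.induction_on with
  | zero => simp
  | tmul c h => exact Submodule.subset_span ⟨(c, h), rfl⟩
  | add x y hx hy => rw [map_add]; exact add_mem hx hy

/-- The linear map `C ⊗ H → C × H`, `c ⊗ h ↦ c × h = c⁰ ⊗ h₂ ε_H(c⁻¹ h₁)`. -/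
def toSmash : C ⊗[k] H →ₗ[k] smash ρ :=
  (smashMap ρ).codRestrict (smash ρ) (smashMap_mem ρ)

/-- The element `c × h` of the weak smash coproduct. -/
def cross (c : C) (h : H) : smash ρ := toSmash ρ (c ⊗ₜ[k] h)

/-- The linear map `c ⊗ h ↦ c⁰ ⊗ c⁻¹ h`. -/
def twist : C ⊗[k] H →ₗ[k] C ⊗[k] H :=
  (LinearMap.mul' k H).lTensor C ∘ₗ (TensorProduct.assoc k C H H).toLinearMap ∘ₗ
    (TensorProduct.comm k H C).toLinearMap.rTensor H ∘ₗ ρ.rTensor H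

variable [Coalgebra k C]

/-- The linear map `c ⊗ h ↦ (c₁ ⊗ c₂⁻¹ h₁) ⊗ (c₂⁰ ⊗ h₂)`. -/
def smashComul : C ⊗[k] H →ₗ[k] (C ⊗[k] H) ⊗[k] (C ⊗[k] H) :=
  ((LinearMap.mul' k H).lTensor C ∘ₗ
      (TensorProduct.assoc k C H H).toLinearMap).rTensor (C ⊗[k] H) ∘ₗ
    (TensorProduct.tensorTensorTensorComm k (C ⊗[k] H) C H H).toLinearMap ∘ₗ
    TensorProduct.map
      ((TensorProduct.assoc k C H C).symm.toLinearMap ∘ₗ ρ.lTensor C ∘ₗ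
        Coalgebra.comul (R := k) (A := C))
      (Coalgebra.comul (R := k) (A := H))

/-- The linear map `c ⊗ h ↦ ε_C(c⁰) ε_H(c⁻¹ h)`. -/
def smashCounit : C ⊗[k] H →ₗ[k] k :=
  LinearMap.mul' k k ∘ₗ
    TensorProduct.map (Coalgebra.counit (R := k) (A := C)) (Coalgebra.counit (R := k) (A := H)) ∘ₗ
    twist ρ

/-- The linear map `c ⊗ h ↦ S_C(c⁰) ⊗ S_H(c⁻¹ h)`. -/
def smashAntipode (SC : C →ₗ[k] C) (SH : H →ₗ[k] H) : C ⊗[k] H →ₗ[k] C ⊗[k] H :=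
  TensorProduct.map SC SH ∘ₗ twist ρ

end Smash

end WeakHopf

end

/-!
The weak smash coproduct is a quotient of the algebra `C ⊗ H`. Write `E = 1⁰ ⊗ ε_t(1⁻¹)`. Since `H`
is commutative, its target map is multiplicative, and the comodule axioms give
`c⁰ ⊗ ε_t(c⁻¹) = E (c ⊗ 1) = (c ⊗ 1) E` (`sw_coact_εt_left`, `sw_coact_εt_right`). Hence `E` is a
central idempotent and `c × h = E (c ⊗ h)` (`smashMap_eq`), so that `C × H = E (C ⊗ H)`, and the
product of `C × H` is the one of `C ⊗ H`.

The formulas in the theorem define maps `Δ'`, `ε'`, `S'` on `C ⊗ H`. They satisfy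
`Δ'(E x) = (E ⊗ 1) Δ'(x)`, `ε'(E x) = ε'(x)`, `S'(E x) = S'(x)`, and therefore descend to `C × H`.
It remains to prove the axioms of a weak Hopf algebra for `Δ'`, `ε'`, `S'` modulo `E`
(`IsWeakHopfAlgebra.of_surjective`).

* `Δ'` is multiplicative because `H` is commutative, and it is coassociative already on `C ⊗ H`.
* The counit is `ε_C ⊗ ε_H` after the twist `c ⊗ h ↦ c⁰ ⊗ c⁻¹h`, which is multiplicative;
  this reduces the weak multiplicativity of `ε'` to those of `ε_C` and `ε_H`.
* Expanding `(I ⊗ Δ')Δ'(1)` with the weak comultiplicativity of `1_C` and `1_H` leaves an additional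
  factor `1⁻¹`. Since `1⁻¹ ∈ H_s`, it moves across `Δ(1_H)` and becomes `ε_t(1⁻¹)`, which is
  absorbed by `E` (`sw_coact_one_absorb`).
* Both `x₁ S'(x₂)` and `ε_t(x)` equal `ε_t(c⁰) ⊗ ε_t(c⁻¹h)` for `x = c ⊗ h`, modulo `E`; both
  `S'(x₁) x₂` and `ε_s(x)` equal `ε_s(c⁰) ⊗ S_H(c⁻¹) ε_s(h)`. The axiom
  `c⁻¹ ε_C(c⁰) = ε_t(c⁻¹) ε_C(c⁰)` and the multiplicativity of `S_H` (`antipode_mul`) enter here.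

Sweedler's notation is made precise by `sw t F`, the sum of the values of a bilinear function `F`
over an expression of `t` by pure tensors. The bilinearity that the rewriting rules for such sums
require is a side goal for `fun_prop`.
-/

open scoped TensorProduct

noncomputable section

namespace WeakHopf

/-! ### Sums over tensors and unbundled linearity -/

section Sweedler

variable {k X Y Z W M N : Type*} [Field k] [AddCommGroup X] [Module k X]
  [AddCommGroup Y] [Module k Y] [AddCommGroup Z] [Module k Z] [AddCommGroup W] [Module k W]
  [AddCommGroup M] [Module k M] [AddCommGroup N] [Module k N]

variable (k) in
/-- `k`-linearity of an unbundled function, as a property that `fun_prop` can establish. -/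
@[fun_prop]
def Lin (f : X → Y) : Prop := IsLinearMap k f

@[fun_prop]
theorem lin_id : Lin k (fun x : X => x) := ⟨fun _ _ => rfl, fun _ _ => rfl⟩

@[fun_prop]
theorem Lin.comp {f : Y → Z} {g : X → Y} (hf : Lin k f) (hg : Lin k g) :
    Lin k (fun x => f (g x)) :=
  ⟨fun _ _ => by rw [hg.map_add, hf.map_add], fun _ _ => by rw [hg.map_smul, hf.map_smul]⟩

@[fun_prop]
theorem lin_coe (f : X →ₗ[k] Y) : Lin k (fun x => f x) := ⟨f.map_add, f.map_smul⟩

@[fun_prop]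
theorem lin_coe_equiv (f : X ≃ₗ[k] Y) : Lin k (fun x => f x) := ⟨f.map_add, f.map_smul⟩

@[fun_prop]
theorem Lin.coe_left {f : X → Y →ₗ[k] Z} (hf : Lin k f) (y : Y) : Lin k (fun x => f x y) :=
  ⟨fun _ _ => by simp [hf.map_add], fun _ _ => by simp [hf.map_smul]⟩

@[fun_prop]
theorem Lin.tmul_left {f : X → Y} (hf : Lin k f) (z : Z) : Lin k (fun x => f x ⊗ₜ[k] z) :=
  ⟨fun _ _ => by simp [hf.map_add, TensorProduct.add_tmul],
    fun _ _ => by simp [hf.map_smul, TensorProduct.smul_tmul']⟩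

@[fun_prop]
theorem Lin.tmul_right {f : X → Y} (hf : Lin k f) (z : Z) : Lin k (fun x => z ⊗ₜ[k] f x) :=
  ⟨fun _ _ => by simp [hf.map_add, TensorProduct.tmul_add], fun _ _ => by simp [hf.map_smul]⟩

@[fun_prop]
theorem Lin.smul_left {f : X → k} (hf : Lin k f) (z : Z) : Lin k (fun x => f x • z) :=
  ⟨fun _ _ => by simp [hf.map_add, add_smul], fun _ _ => by simp [hf.map_smul, mul_smul]⟩

@[fun_prop]
theorem Lin.smul_right {f : X → Y} (hf : Lin k f) (r : k) : Lin k (fun x => r • f x) :=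
  ⟨fun _ _ => by simp [hf.map_add], fun _ _ => by simp [hf.map_smul, smul_comm r]⟩

@[fun_prop]
theorem Lin.mul_left {V : Type*} [Ring V] [Algebra k V] {f : X → V} (hf : Lin k f) (z : V) :
    Lin k (fun x => f x * z) :=
  ⟨fun _ _ => by simp [hf.map_add, add_mul], fun _ _ => by simp [hf.map_smul]⟩

@[fun_prop]
theorem Lin.mul_right {V : Type*} [Ring V] [Algebra k V] {f : X → V} (hf : Lin k f) (z : V) :
    Lin k (fun x => z * f x) :=
  ⟨fun _ _ => by simp [hf.map_add, mul_add], fun _ _ => by simp [hf.map_smul]⟩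

/-- The sum `∑ F(aᵢ, bᵢ)` over a chosen expression `t = ∑ aᵢ ⊗ bᵢ` of `t` as a sum of pure tensors.
For bilinear `F` it does not depend on the choice, and `sw (Δ x) F` is what Sweedler's notation
writes as `F(x₁, x₂)`. -/
def sw {M : Type*} [AddCommMonoid M] (t : X ⊗[k] Y) (F : X → Y → M) : M :=
  ((TensorProduct.exists_multiset t).choose.map fun p => F p.1 p.2).sum

theorem sw_tmul_eq (t : X ⊗[k] Y) : sw t (fun a b => a ⊗ₜ[k] b) = t :=
  (TensorProduct.exists_multiset t).choose_spec.symm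

theorem map_sw (G : M →ₗ[k] N) (t : X ⊗[k] Y) (F : X → Y → M) :
    G (sw t F) = sw t fun a b => G (F a b) := by
  simp [sw, map_multiset_sum]

theorem Lin.map_sw {G : M → N} (hG : Lin k G) (t : X ⊗[k] Y) (F : X → Y → M) :
    G (sw t F) = sw t fun a b => G (F a b) :=
  WeakHopf.map_sw (IsLinearMap.mk' G hG) t F

theorem smul_sw (r : k) (t : X ⊗[k] Y) (F : X → Y → M) :
    r • sw t F = sw t fun a b => r • F a b :=
  Lin.map_sw (by fun_prop) t F

/-- A linear map on a tensor product is the sum of its values on pure tensors. -/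
theorem Lin.eq_sw {G : X ⊗[k] Y → N} (hG : Lin k G) (t : X ⊗[k] Y) :
    G t = sw t fun a b => G (a ⊗ₜ b) := by
  conv_lhs => rw [← sw_tmul_eq t]
  rw [hG.map_sw]

theorem Lin.ext_tmul {f g : X ⊗[k] Y → N} (hf : Lin k f) (hg : Lin k g)
    (h : ∀ a b, f (a ⊗ₜ b) = g (a ⊗ₜ b)) (t : X ⊗[k] Y) : f t = g t := by
  rw [hf.eq_sw, hg.eq_sw]
  simp only [h]

/-- The linear map out of the tensor product given by an unbundled bilinear function. -/
def bil (F : X → Y → M) (h1 : ∀ b, Lin k fun a => F a b) (h2 : ∀ a, Lin k fun b => F a b) :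
    X ⊗[k] Y →ₗ[k] M :=
  TensorProduct.lift (LinearMap.mk₂ k F (fun a a' b => (h1 b).map_add a a')
    (fun r a b => (h1 b).map_smul r a) (fun a => (h2 a).map_add) (fun r a => (h2 a).map_smul r))

theorem sw_eq_bil (F : X → Y → M) (h1 : ∀ b, Lin k fun a => F a b)
    (h2 : ∀ a, Lin k fun b => F a b) (t) : sw t F = bil F h1 h2 t := by
  rw [(lin_coe (bil F h1 h2)).eq_sw]; rfl

@[fun_prop]
theorem lin_sw (F : X → Y → M) (h1 : ∀ b, Lin k fun a => F a b) (h2 : ∀ a, Lin k fun b => F a b) :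
    Lin k (fun t : X ⊗[k] Y => sw t F) := by
  simp only [sw_eq_bil F h1 h2]; fun_prop

@[fun_prop]
theorem Lin.sw_right (t : X ⊗[k] Y) (F : Z → X → Y → M) (h : ∀ a b, Lin k fun z => F z a b) :
    Lin k (fun z => sw t (F z)) := by
  constructor
  · intro z z'
    have : ∀ p : X × Y, F (z + z') p.1 p.2 = F z p.1 p.2 + F z' p.1 p.2 :=
      fun p => (h p.1 p.2).map_add z z'
    simp [WeakHopf.sw, this]
  · intro r z
    have : ∀ p : X × Y, F (r • z) p.1 p.2 = r • F z p.1 p.2 :=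
      fun p => (h p.1 p.2).map_smul r z
    simp [WeakHopf.sw, this, Multiset.smul_sum]

theorem sw_congr {M : Type*} [AddCommMonoid M] (t : X ⊗[k] Y) {F G : X → Y → M}
    (h : ∀ a b, F a b = G a b) : sw t F = sw t G := by
  have : F = G := funext fun a => funext fun b => h a b
  rw [this]

theorem sw_swap {M : Type*} [AddCommMonoid M] (t : X ⊗[k] Y) (s : Z ⊗[k] W)
    (F : X → Y → Z → W → M) :
    sw t (fun a b => sw s fun c d => F a b c d) = sw s fun c d => sw t fun a b => F a b c d :=
  Multiset.sum_map_sum_map _ _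

/-! ### Evaluation of sums over tensors -/

theorem sw_tmul (x : X) (y : Y) (F : X → Y → M) (h1 : ∀ b, Lin k fun a => F a b)
    (h2 : ∀ a, Lin k fun b => F a b) : sw (x ⊗ₜ[k] y) F = F x y := by
  rw [sw_eq_bil F h1 h2]; rfl

theorem sw_map (f : X →ₗ[k] Z) (g : Y →ₗ[k] W) (t : X ⊗[k] Y) (F : Z → W → M)
    (h1 : ∀ b, Lin k fun a => F a b) (h2 : ∀ a, Lin k fun b => F a b) :
    sw (TensorProduct.map f g t) F = sw t fun a b => F (f a) (g b) := by
  rw [Lin.eq_sw (G := fun t => sw (TensorProduct.map f g t) F) (by fun_prop)]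
  simp (disch := fun_prop) only [TensorProduct.map_tmul, sw_tmul]

theorem sw_rTensor (f : X →ₗ[k] Z) (t : X ⊗[k] Y) (F : Z → Y → M)
    (h1 : ∀ b, Lin k fun a => F a b) (h2 : ∀ a, Lin k fun b => F a b) :
    sw (f.rTensor Y t) F = sw t fun a b => F (f a) b :=
  sw_map f LinearMap.id t F h1 h2

theorem sw_lTensor (g : Y →ₗ[k] W) (t : X ⊗[k] Y) (F : X → W → M)
    (h1 : ∀ b, Lin k fun a => F a b) (h2 : ∀ a, Lin k fun b => F a b) :
    sw (g.lTensor X t) F = sw t fun a b => F a (g b) :=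
  sw_map LinearMap.id g t F h1 h2

theorem sw_assoc (t : (X ⊗[k] Y) ⊗[k] Z) (F : X → Y ⊗[k] Z → M)
    (h1 : ∀ b, Lin k fun a => F a b) (h2 : ∀ a, Lin k fun b => F a b) :
    sw (TensorProduct.assoc k X Y Z t) F = sw t fun u c => sw u fun a b => F a (b ⊗ₜ c) := by
  rw [Lin.eq_sw (G := fun t => sw (TensorProduct.assoc k X Y Z t) F) (by fun_prop)]
  refine sw_congr _ fun u c => ?_
  rw [Lin.eq_sw (G := fun u => sw (TensorProduct.assoc k X Y Z (u ⊗ₜ c)) F) (by fun_prop)]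
  simp (disch := fun_prop) only [TensorProduct.assoc_tmul, sw_tmul]

theorem sw_assoc_symm (t : X ⊗[k] (Y ⊗[k] Z)) (F : X ⊗[k] Y → Z → M)
    (h1 : ∀ b, Lin k fun a => F a b) (h2 : ∀ a, Lin k fun b => F a b) :
    sw ((TensorProduct.assoc k X Y Z).symm t) F =
      sw t fun a u => sw u fun b c => F (a ⊗ₜ b) c := by
  rw [Lin.eq_sw (G := fun t => sw ((TensorProduct.assoc k X Y Z).symm t) F) (by fun_prop)]
  refine sw_congr _ fun a u => ?_
  rw [Lin.eq_sw (G := fun u => sw ((TensorProduct.assoc k X Y Z).symm (a ⊗ₜ u)) F) (by fun_prop)]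
  simp (disch := fun_prop) only [TensorProduct.assoc_symm_tmul, sw_tmul]

theorem sw_comm (t : X ⊗[k] Y) (F : Y → X → M)
    (h1 : ∀ b, Lin k fun a => F a b) (h2 : ∀ a, Lin k fun b => F a b) :
    sw (TensorProduct.comm k X Y t) F = sw t fun a b => F b a := by
  rw [Lin.eq_sw (G := fun t => sw (TensorProduct.comm k X Y t) F) (by fun_prop)]
  simp (disch := fun_prop) only [TensorProduct.comm_tmul, sw_tmul]

theorem sw_tensorTensorTensorComm (t : (X ⊗[k] Y) ⊗[k] (Z ⊗[k] W))
    (F : X ⊗[k] Z → Y ⊗[k] W → M)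
    (h1 : ∀ b, Lin k fun a => F a b) (h2 : ∀ a, Lin k fun b => F a b) :
    sw (TensorProduct.tensorTensorTensorComm k X Y Z W t) F =
      sw t fun u v => sw u fun a b => sw v fun c d => F (a ⊗ₜ c) (b ⊗ₜ d) := by
  rw [Lin.eq_sw (G := fun t => sw (TensorProduct.tensorTensorTensorComm k X Y Z W t) F)
    (by fun_prop)]
  refine sw_congr _ fun u v => ?_
  rw [Lin.eq_sw (G := fun u => sw (TensorProduct.tensorTensorTensorComm k X Y Z W (u ⊗ₜ v)) F)
    (by fun_prop)]
  refine sw_congr _ fun a b => ?_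
  rw [Lin.eq_sw (G := fun v => sw (TensorProduct.tensorTensorTensorComm k X Y Z W
    ((a ⊗ₜ b) ⊗ₜ v)) F) (by fun_prop)]
  simp (disch := fun_prop) only [TensorProduct.tensorTensorTensorComm_tmul, sw_tmul]

theorem sw_map₂ {X' Y' : Type*} [AddCommGroup X'] [Module k X'] [AddCommGroup Y'] [Module k Y']
    (f : X →ₗ[k] X' →ₗ[k] Z) (g : Y →ₗ[k] Y' →ₗ[k] W) (t : X ⊗[k] Y) (s : X' ⊗[k] Y')
    (F : Z → W → M) (h1 : ∀ b, Lin k fun a => F a b) (h2 : ∀ a, Lin k fun b => F a b) :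
    sw (TensorProduct.map₂ f g t s) F =
      sw t fun a b => sw s fun c d => F (f a c) (g b d) := by
  rw [Lin.eq_sw (G := fun t => sw (TensorProduct.map₂ f g t s) F) (by fun_prop)]
  refine sw_congr _ fun a b => ?_
  rw [Lin.eq_sw (G := fun s => sw (TensorProduct.map₂ f g (a ⊗ₜ b) s) F) (by fun_prop)]
  simp (disch := fun_prop) only [TensorProduct.map₂_apply_tmul, TensorProduct.map_tmul, sw_tmul]

theorem sw_mul {V U : Type*} [Ring V] [Algebra k V] [Ring U] [Algebra k U] (t s : V ⊗[k] U)
    (F : V → U → M) (h1 : ∀ b, Lin k fun a => F a b) (h2 : ∀ a, Lin k fun b => F a b) :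
    sw (t * s) F = sw t fun a b => sw s fun c d => F (a * c) (b * d) := by
  rw [Lin.eq_sw (G := fun t => sw (t * s) F) (by fun_prop)]
  refine sw_congr _ fun a b => ?_
  rw [Lin.eq_sw (G := fun s => sw (a ⊗ₜ[k] b * s) F) (by fun_prop)]
  simp (disch := fun_prop) only [Algebra.TensorProduct.tmul_mul_tmul, sw_tmul]

theorem eq_of_sw_eq {t s : X ⊗[k] Y}
    (h : sw t (fun a b => a ⊗ₜ[k] b) = sw s fun a b => a ⊗ₜ[k] b) : t = s := by
  rwa [sw_tmul_eq, sw_tmul_eq] at h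

theorem eq_of_sw_sw_eq {t s : X ⊗[k] (Y ⊗[k] Z)}
    (h : sw t (fun a u => sw u fun b c => a ⊗ₜ[k] (b ⊗ₜ[k] c)) =
      sw s fun a u => sw u fun b c => a ⊗ₜ[k] (b ⊗ₜ[k] c)) : t = s := by
  have h' (a : X) (u : Y ⊗[k] Z) : sw u (fun b c => a ⊗ₜ[k] (b ⊗ₜ[k] c)) = a ⊗ₜ[k] u := by
    conv_rhs => rw [← sw_tmul_eq u]
    rw [Lin.map_sw (k := k) (G := fun v => a ⊗ₜ[k] v) (by fun_prop)]
  simp only [h'] at h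
  exact eq_of_sw_eq h

theorem lift_eq_sw (f : X →ₗ[k] Y →ₗ[k] M) (t : X ⊗[k] Y) :
    TensorProduct.lift f t = sw t fun a b => f a b := by
  rw [(lin_coe _).eq_sw]; rfl

theorem lid_eq_sw (t : k ⊗[k] X) : TensorProduct.lid k X t = sw t fun a b => a • b := by
  rw [Lin.eq_sw (G := fun t => TensorProduct.lid k X t) (by fun_prop)]
  simp only [TensorProduct.lid_tmul]

theorem rid_eq_sw (t : X ⊗[k] k) : TensorProduct.rid k X t = sw t fun a b => b • a := by
  rw [Lin.eq_sw (G := fun t => TensorProduct.rid k X t) (by fun_prop)]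
  simp only [TensorProduct.rid_tmul]

theorem mul'_eq_sw {V : Type*} [Ring V] [Algebra k V] (t : V ⊗[k] V) :
    LinearMap.mul' k V t = sw t fun a b => a * b := by
  rw [(lin_coe _).eq_sw]; rfl

end Sweedler

/-! ### Weak bialgebras -/

section WeakBialgebra

variable {k V M : Type*} [Field k] [Ring V] [Algebra k V] [Coalgebra k V]
  [AddCommGroup M] [Module k M]

local notation "Δ" => Coalgebra.comul (R := k)
local notation "ε" => Coalgebra.counit (R := k)

variable (k V) in
/-- The algebra and coalgebra `V` is a weak bialgebra. -/
abbrev IsWeakBialg : Prop :=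
  IsWeakBialgebra (LinearMap.mul k V) 1 (Coalgebra.comul (R := k) (A := V))
    (Coalgebra.counit (R := k) (A := V))

theorem sw_coassoc (x : V) (F : V → V → V → M) (h1 : ∀ b c, Lin k fun a => F a b c)
    (h2 : ∀ a c, Lin k fun b => F a b c) (h3 : ∀ a b, Lin k fun c => F a b c) :
    sw (Δ x) (fun a b => sw (Δ a) fun c d => F c d b) =
      sw (Δ x) fun a b => sw (Δ b) fun c d => F a c d := by
  have := congrArg (fun t => sw t fun a u => sw u fun b c => F a b c)
    (Coalgebra.coassoc_apply (R := k) x)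
  simpa (disch := fun_prop) only [sw_assoc, sw_rTensor, sw_lTensor, sw_tmul] using this

theorem sw_counit_left (x : V) (F : V → M) (h : Lin k F) :
    sw (Δ x) (fun a b => ε a • F b) = F x := by
  have := congrArg (fun t => sw t fun a b => a • F b) (Coalgebra.rTensor_counit_comul (R := k) x)
  simpa (disch := fun_prop) only [sw_rTensor, sw_tmul, one_smul] using this

theorem sw_counit_right (x : V) (F : V → M) (h : Lin k F) :
    sw (Δ x) (fun a b => ε b • F a) = F x := by
  have := congrArg (fun t => sw t fun a b => b • F a) (Coalgebra.lTensor_counit_comul (R := k) x)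
  simpa (disch := fun_prop) only [sw_lTensor, sw_tmul, one_smul] using this

theorem sw_comul_mul (hV : IsWeakBialg k V) (x y : V) (F : V → V → M)
    (h1 : ∀ b, Lin k fun a => F a b) (h2 : ∀ a, Lin k fun b => F a b) :
    sw (Δ (x * y)) F = sw (Δ x) fun a b => sw (Δ y) fun c d => F (a * c) (b * d) := by
  have := congrArg (fun t => sw t F) (hV.comul_mul x y)
  simpa (disch := fun_prop) only [sw_map₂, LinearMap.mul_apply_apply] using this

/-- `F(1₁, 1'₁ 1₂, 1'₂) = F(1₁, 1₂, 1₃)` -/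
theorem sw_comul_one_left (hV : IsWeakBialg k V) (F : V → V → V → M)
    (h1 : ∀ b c, Lin k fun a => F a b c) (h2 : ∀ a c, Lin k fun b => F a b c)
    (h3 : ∀ a b, Lin k fun c => F a b c) :
    sw (Δ (1 : V)) (fun a b => sw (Δ (1 : V)) fun c d => F a (c * b) d) =
      sw (Δ (1 : V)) fun a b => sw (Δ b) fun c d => F a c d := by
  have := congrArg (fun t => sw t fun a u => sw u fun b c => F a b c) hV.comul_one_left
  simp (disch := fun_prop) only [sw_map₂, sw_assoc, sw_lTensor, sw_tmul, LinearMap.mul_apply_apply,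
    one_mul, mul_one] at this
  exact this

/-- `F(1₁, 1₂ 1'₁, 1'₂) = F(1₁, 1₂, 1₃)` -/
theorem sw_comul_one_right (hV : IsWeakBialg k V) (F : V → V → V → M)
    (h1 : ∀ b c, Lin k fun a => F a b c) (h2 : ∀ a c, Lin k fun b => F a b c)
    (h3 : ∀ a b, Lin k fun c => F a b c) :
    sw (Δ (1 : V)) (fun a b => sw (Δ (1 : V)) fun c d => F a (b * c) d) =
      sw (Δ (1 : V)) fun a b => sw (Δ b) fun c d => F a c d := by
  have := congrArg (fun t => sw t fun a u => sw u fun b c => F a b c) hV.comul_one_right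
  simp (disch := fun_prop) only [sw_map₂, sw_assoc, sw_lTensor, sw_tmul, LinearMap.mul_apply_apply,
    one_mul, mul_one] at this
  exact this

theorem sw_counit_mul_left (hV : IsWeakBialg k V) (x y z : V) (m : M) :
    sw (Δ y) (fun a b => ε (x * a) • ε (b * z) • m) = ε (x * y * z) • m := by
  have := congrArg (fun t => t • m) (hV.counit_mul_left x y z)
  simp (disch := fun_prop) only [mul'_eq_sw, sw_map, LinearMap.comp_apply,
    LinearMap.mul_apply_apply, LinearMap.flip_apply] at this
  rw [this, Lin.map_sw (G := fun r : k => r • m) (by fun_prop)]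
  simp only [mul_smul]

theorem sw_counit_mul_right (hV : IsWeakBialg k V) (x y z : V) (m : M) :
    sw (Δ y) (fun a b => ε (x * b) • ε (a * z) • m) = ε (x * y * z) • m := by
  have := congrArg (fun t => t • m) (hV.counit_mul_right x y z)
  simp (disch := fun_prop) only [mul'_eq_sw, sw_map, LinearMap.comp_apply,
    LinearMap.mul_apply_apply, LinearMap.flip_apply] at this
  rw [this, Lin.map_sw (G := fun r : k => r • m) (by fun_prop)]
  simp only [mul_smul, smul_comm (ε (x * _))]

theorem εt_apply (x : V) : εt k V x = sw (Δ (1 : V)) fun a b => ε (a * x) • b := by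
  simp (disch := fun_prop) only [εt, targetMap, lid_eq_sw, sw_rTensor, sw_map₂, sw_tmul,
    LinearMap.comp_apply, LinearEquiv.coe_coe, LinearMap.flip_apply, TensorProduct.mk_apply,
    LinearMap.mul_apply_apply, mul_one]

theorem εs_apply (x : V) : εs k V x = sw (Δ (1 : V)) fun a b => ε (x * b) • a := by
  simp (disch := fun_prop) only [εs, sourceMap, rid_eq_sw, sw_lTensor, sw_map₂, sw_tmul,
    LinearMap.comp_apply, LinearEquiv.coe_coe, LinearMap.flip_apply, TensorProduct.mk_apply,
    LinearMap.mul_apply_apply, one_mul]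

/-- `ε(x₁ y) x₂ = x ε_t(y)` -/
theorem sw_counit_mul_smul (hV : IsWeakBialg k V) (x y : V) (F : V → M) (h : Lin k F) :
    sw (Δ x) (fun a b => ε (a * y) • F b) = F (x * εt k V y) := by
  calc sw (Δ x) (fun a b => ε (a * y) • F b)
      = sw (Δ (x * 1)) (fun a b => ε (a * y) • F b) := by rw [mul_one]
    _ = sw (Δ x) fun a b => sw (Δ (1 : V)) fun c d => ε (a * c * y) • F (b * d) := by
      rw [sw_comul_mul hV _ _ _ (by fun_prop) (by fun_prop)]
    _ = sw (Δ x) fun a b => sw (Δ (1 : V)) fun c d => sw (Δ c) fun e f =>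
          ε (a * f) • ε (e * y) • F (b * d) := by
      simp only [sw_counit_mul_right hV]
    _ = sw (Δ x) fun a b => sw (Δ (1 : V)) fun c d => sw (Δ d) fun e f =>
          ε (a * e) • ε (c * y) • F (b * f) := by
      simp (disch := fun_prop) only [sw_coassoc]
    _ = sw (Δ (1 : V)) fun c d => sw (Δ (x * d)) fun a b => ε a • ε (c * y) • F b := by
      rw [sw_swap]
      simp (disch := fun_prop) only [sw_comul_mul hV]
    _ = F (x * εt k V y) := by
      simp (disch := fun_prop) only [sw_counit_left]
      rw [εt_apply, Lin.map_sw (G := fun u => F (x * u)) (by fun_prop)]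
      simp only [mul_smul_comm, h.map_smul]

/-- `ε(y x₂) x₁ = ε_s(y) x` -/
theorem sw_counit_mul_smul' (hV : IsWeakBialg k V) (x y : V) (F : V → M) (h : Lin k F) :
    sw (Δ x) (fun a b => ε (y * b) • F a) = F (εs k V y * x) := by
  calc sw (Δ x) (fun a b => ε (y * b) • F a)
      = sw (Δ (1 * x)) (fun a b => ε (y * b) • F a) := by rw [one_mul]
    _ = sw (Δ (1 : V)) fun c d => sw (Δ x) fun a b => ε (y * d * b) • F (c * a) := by
      simp (disch := fun_prop) only [sw_comul_mul hV, mul_assoc]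
    _ = sw (Δ (1 : V)) fun c d => sw (Δ x) fun a b => sw (Δ d) fun e f =>
          ε (y * f) • ε (e * b) • F (c * a) := by
      simp only [sw_counit_mul_right hV]
    _ = sw (Δ (1 : V)) fun c d => sw (Δ d) fun e f => sw (Δ x) fun a b =>
          ε (y * f) • ε (e * b) • F (c * a) := by
      refine sw_congr _ fun c d => sw_swap _ _ _
    _ = sw (Δ (1 : V)) fun c d => sw (Δ c) fun e f => sw (Δ x) fun a b =>
          ε (y * d) • ε (f * b) • F (e * a) := by
      rw [sw_coassoc (1 : V) (fun c e f => sw (Δ x) fun a b => ε (y * f) • ε (e * b) • F (c * a))]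
        <;> fun_prop
    _ = sw (Δ (1 : V)) fun c d => sw (Δ (c * x)) fun a b => ε b • ε (y * d) • F a := by
      simp (disch := fun_prop) only [sw_comul_mul hV, smul_comm (ε (y * _))]
    _ = F (εs k V y * x) := by
      simp (disch := fun_prop) only [sw_counit_right]
      rw [εs_apply, Lin.map_sw (G := fun u => F (u * x)) (by fun_prop)]
      simp only [smul_mul_assoc, h.map_smul]

end WeakBialgebra

/-! ### Commutative weak bialgebras -/

section Commutative

variable {k V M : Type*} [Field k] [CommRing V] [Algebra k V] [Coalgebra k V]
  [AddCommGroup M] [Module k M]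

local notation "Δ" => Coalgebra.comul (R := k)
local notation "ε" => Coalgebra.counit (R := k)

/-- `ε_t(x₁) x₂ = x` -/
theorem sw_εt_mul (hV : IsWeakBialg k V) (x : V) (F : V → M) (h : Lin k F) :
    sw (Δ x) (fun a b => F (εt k V a * b)) = F x := by
  have h1 (a b : V) : F (εt k V a * b) = sw (Δ (1 : V)) fun c d => ε (c * a) • F (d * b) := by
    rw [εt_apply, Lin.map_sw (G := fun u => F (u * b)) (by fun_prop)]
    simp only [smul_mul_assoc, h.map_smul]
  simp only [h1]
  rw [sw_swap, ← sw_comul_mul hV 1 x (fun a b => ε a • F b) (by fun_prop) (by fun_prop), one_mul,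
    sw_counit_left _ _ h]

/-- `Δ(ε_t(y) x) = ε_t(y) x₁ ⊗ x₂` -/
theorem sw_comul_εt_mul (hV : IsWeakBialg k V) (x y : V) (F : V → V → M)
    (h1 : ∀ b, Lin k fun a => F a b) (h2 : ∀ a, Lin k fun b => F a b) :
    sw (Δ (εt k V y * x)) F = sw (Δ x) fun a b => F (εt k V y * a) b := by
  have h (a b : V) : F (εt k V y * a) b = sw (Δ a) fun c d => ε (c * y) • F d b := by
    rw [sw_counit_mul_smul hV a y (fun u => F u b) (by fun_prop), mul_comm]
  simp only [h]
  rw [mul_comm, ← sw_counit_mul_smul hV x y (fun z => sw (Δ z) F) (by fun_prop)]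
  simp (disch := fun_prop) only [sw_coassoc, smul_sw]

/-- `Δ(ε_s(y) x) = x₁ ⊗ ε_s(y) x₂` -/
theorem sw_comul_εs_mul (hV : IsWeakBialg k V) (x y : V) (F : V → V → M)
    (h1 : ∀ b, Lin k fun a => F a b) (h2 : ∀ a, Lin k fun b => F a b) :
    sw (Δ (εs k V y * x)) F = sw (Δ x) fun a b => F a (εs k V y * b) := by
  have h (a b : V) : F a (εs k V y * b) = sw (Δ b) fun c d => ε (y * d) • F a c := by
    rw [sw_counit_mul_smul' hV b y (fun u => F a u) (by fun_prop)]
  simp only [h]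
  rw [← sw_counit_mul_smul' hV x y (fun z => sw (Δ z) F) (by fun_prop)]
  simp (disch := fun_prop) only [← sw_coassoc, smul_sw]

/-- In a commutative weak bialgebra the target map is multiplicative: by
`Δ(ε_t(x)) = ε_t(x) 1₁ ⊗ 1₂`, the product `ε_t(x) ε_t(y)` is `ε(ε_t(x) 1₁ y) 1₂ = ε(x 1₁ y) 1₂`. -/
theorem εt_mul (hV : IsWeakBialg k V) (x y : V) : εt k V (x * y) = εt k V x * εt k V y := by
  have h (u : V) : ε (u * εt k V x) = ε (u * x) := by
    rw [← sw_counit_mul_smul hV u x (fun v => ε v) (by fun_prop)]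
    simpa only [smul_eq_mul, mul_comm] using
      sw_counit_right (k := k) u (fun v => ε (v * x)) (by fun_prop)
  have h' := sw_counit_mul_smul hV (εt k V x * 1) y (fun v => v) (by fun_prop)
  rw [sw_comul_εt_mul hV _ _ _ (by fun_prop) (by fun_prop)] at h'
  rw [mul_one] at h'
  rw [← h', εt_apply]
  refine sw_congr _ fun a b => ?_
  rw [mul_comm x, ← mul_assoc, ← h (a * y), mul_right_comm, mul_comm a]

/-- In a commutative weak bialgebra the source map is multiplicative, like the target map. -/
theorem εs_mul (hV : IsWeakBialg k V) (x y : V) : εs k V (x * y) = εs k V x * εs k V y := by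
  have h (u : V) : ε (εs k V y * u) = ε (y * u) := by
    rw [← sw_counit_mul_smul' hV u y (fun v => ε v) (by fun_prop)]
    simpa only [smul_eq_mul, mul_comm] using
      sw_counit_left (k := k) u (fun v => ε (v * y)) (by fun_prop)
  have h' := sw_counit_mul_smul' hV (εs k V y * 1) x (fun v => v) (by fun_prop)
  rw [sw_comul_εs_mul hV _ _ _ (by fun_prop) (by fun_prop)] at h'
  rw [mul_one] at h'
  rw [← h', εs_apply]
  refine sw_congr _ fun a b => ?_
  rw [mul_left_comm, h, mul_comm x, mul_assoc]

/-- `x₁ ⊗ ε_t(x₂) = 1₁ x ⊗ 1₂` -/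
theorem sw_εt_right (hV : IsWeakBialg k V) (x : V) (F : V → V → M)
    (h1 : ∀ b, Lin k fun a => F a b) (h2 : ∀ a, Lin k fun b => F a b) :
    sw (Δ x) (fun a b => F a (εt k V b)) = sw (Δ (1 : V)) fun a b => F (a * x) b := by
  have h (a b : V) : F (a * x) b =
      sw (Δ a) fun e f => sw (Δ x) fun c d => ε (f * d) • F (e * c) b := by
    rw [← sw_comul_mul hV a x (fun u v => ε v • F u b) (by fun_prop) (by fun_prop),
      sw_counit_right (a * x) (fun u => F u b) (by fun_prop)]
  have h' (a b : V) : F a (εt k V b) = sw (Δ (1 : V)) fun c d => ε (c * b) • F a d := by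
    rw [εt_apply, Lin.map_sw (h2 a)]
    simp only [(h2 a).map_smul]
  calc sw (Δ x) (fun a b => F a (εt k V b))
      = sw (Δ (1 * x)) (fun a b => sw (Δ (1 : V)) fun e f => ε (e * b) • F a f) := by
        simp only [h', one_mul]
    _ = sw (Δ (1 : V)) fun c d => sw (Δ (1 : V)) fun e f => sw (Δ x) fun a b =>
          ε (e * d * b) • F (c * a) f := by
        simp (disch := fun_prop) only [sw_comul_mul hV, mul_assoc]
        exact sw_congr _ fun c d => sw_swap _ _ _
    _ = sw (Δ (1 : V)) fun a b => sw (Δ a) fun e f => sw (Δ x) fun c d =>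
          ε (f * d) • F (e * c) b := by
        rw [sw_comul_one_left hV (fun a b c => sw (Δ x) fun p q => ε (b * q) • F (a * p) c),
          sw_coassoc] <;> fun_prop
    _ = _ := by simp only [h]

/-- `1₁ ε_s(x) ⊗ 1₂ = 1₁ ⊗ 1₂ ε_t(ε_s(x))` -/
theorem sw_comul_one_mul_εs (hV : IsWeakBialg k V) (x : V) (F : V → V → M)
    (h1 : ∀ b, Lin k fun a => F a b) (h2 : ∀ a, Lin k fun b => F a b) :
    sw (Δ (1 : V)) (fun a b => F (a * εs k V x) b) =
      sw (Δ (1 : V)) fun a b => F a (b * εt k V (εs k V x)) := by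
  have h := sw_comul_εs_mul hV 1 x (fun a b => F a (εt k V b)) (by fun_prop) (by fun_prop)
  rw [mul_one] at h
  rw [← sw_εt_right hV _ F h1 h2, h]
  simp only [εt_mul hV]
  rw [sw_εt_right hV 1 (fun a b => F a (εt k V (εs k V x) * b)) (by fun_prop) (by fun_prop)]
  simp only [mul_one, mul_comm]

/-- `ε_t(x₁) ε(x₂ y) = ε_t(xy)` -/
theorem sw_counit_mul_εt (hV : IsWeakBialg k V) (x y : V) (F : V → M) (h : Lin k F) :
    sw (Δ x) (fun a b => ε (b * y) • F (εt k V a)) = F (εt k V (x * y)) := by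
  have h' (a : V) : F (εt k V a) = sw (Δ (1 : V)) fun c d => ε (c * a) • F d := by
    rw [εt_apply, Lin.map_sw h]
    simp only [h.map_smul]
  simp only [h', smul_sw]
  rw [sw_swap]
  refine sw_congr _ fun c d => ?_
  rw [← mul_assoc, ← sw_counit_mul_left hV c x y (F d)]
  simp only [smul_comm (ε (c * _))]

end Commutative

/-! ### Antipodes -/

section Antipode

variable {k V M : Type*} [Field k] [Ring V] [Algebra k V] [Coalgebra k V]
  [AddCommGroup M] [Module k M]

local notation "Δ" => Coalgebra.comul (R := k)
local notation "ε" => Coalgebra.counit (R := k)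

theorem sw_mul_antipode {S : V →ₗ[k] V} (hS : IsAntipode S) (x : V) (F : V → M) (h : Lin k F) :
    sw (Δ x) (fun a b => F (a * S b)) = F (εt k V x) := by
  have := congrArg F (hS.mul_antipode x)
  simp (disch := fun_prop) only [lift_eq_sw, sw_lTensor] at this
  rw [Lin.map_sw h] at this
  exact this

theorem sw_antipode_mul {S : V →ₗ[k] V} (hS : IsAntipode S) (x : V) (F : V → M) (h : Lin k F) :
    sw (Δ x) (fun a b => F (S a * b)) = F (εs k V x) := by
  have := congrArg F (hS.antipode_mul x)
  simp (disch := fun_prop) only [lift_eq_sw, sw_rTensor] at this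
  rw [Lin.map_sw h] at this
  exact this

/-- `S(x₁) ε_t(x₂) = S(x)` -/
theorem sw_antipode_mul_εt {S : V →ₗ[k] V} (hS : IsAntipode S) (x : V) (F : V → M) (h : Lin k F) :
    sw (Δ x) (fun a b => F (S a * εt k V b)) = F (S x) := by
  have := congrArg F (hS.antipode_mul_antipode x)
  simp (disch := fun_prop) only [lift_eq_sw, sw_map, LinearMap.comp_apply, sw_rTensor,
    LinearMap.mul_apply_apply] at this
  rw [← this, Lin.map_sw h]
  have h' (a b : V) : F (sw (Δ a) (fun c d => S c * d) * S b) =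
      sw (Δ a) fun c d => F (S c * d * S b) := by
    rw [Lin.map_sw (G := fun u => F (u * S b)) (by fun_prop)]
  simp only [h']
  rw [sw_coassoc x (fun a b c => F (S a * b * S c)) (by fun_prop) (by fun_prop) (by fun_prop)]
  refine sw_congr _ fun a b => ?_
  simp only [mul_assoc]
  rw [sw_mul_antipode hS b (fun u => F (S a * u)) (by fun_prop)]

end Antipode

section CommutativeAntipode

variable {k V M : Type*} [Field k] [CommRing V] [Algebra k V] [Coalgebra k V]
  [AddCommGroup M] [Module k M]

local notation "Δ" => Coalgebra.comul (R := k)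

/-- `ε_s(x₁) S(x₂) = S(x)` -/
theorem sw_εs_mul_antipode {S : V →ₗ[k] V} (hS : IsAntipode S) (x : V) (F : V → M) (h : Lin k F) :
    sw (Δ x) (fun a b => F (εs k V a * S b)) = F (S x) := by
  rw [← sw_antipode_mul_εt hS x F h]
  have h1 (a b : V) : F (εs k V a * S b) = sw (Δ a) fun c d => F (S c * d * S b) :=
    (sw_antipode_mul hS a (fun u => F (u * S b)) (by fun_prop)).symm
  have h2 (a b : V) : F (S a * εt k V b) = sw (Δ b) fun c d => F (S a * (c * S d)) :=
    (sw_mul_antipode hS b (fun u => F (S a * u)) (by fun_prop)).symm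
  simp only [h1, h2, ← mul_assoc]
  exact sw_coassoc x (fun a b c => F (S a * b * S c)) (by fun_prop) (by fun_prop) (by fun_prop)

/-- The antipode of a commutative weak Hopf algebra is multiplicative. Both `S(xy)` and `S(x)S(y)`
are generalized inverses of `xy` for the convolution product, with the same one-sided units
`ε_s(x)ε_s(y)` and `ε_t(x)ε_t(y)`. -/
theorem antipode_mul {S : V →ₗ[k] V} (hS : IsAntipode S) (x y : V) : S (x * y) = S x * S y := by
  have hV : IsWeakBialg k V := hS.toIsWeakBialgebra
  calc S (x * y)
      = sw (Δ x) fun a b => sw (Δ y) fun c d => εs k V (a * c) * S (b * d) := by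
        rw [← sw_comul_mul hV x y (fun a b => εs k V a * S b) (by fun_prop) (by fun_prop),
          sw_εs_mul_antipode hS (x * y) (fun u => u) (by fun_prop)]
    _ = sw (Δ x) fun a b => sw (Δ a) fun a₁ a₂ => sw (Δ y) fun c d => sw (Δ c) fun c₁ c₂ =>
          S a₁ * a₂ * (S c₁ * c₂) * S (b * d) := by
        refine sw_congr _ fun a b => ?_
        rw [sw_swap]
        refine sw_congr _ fun c d => ?_
        rw [sw_antipode_mul hS a (fun u => sw (Δ c) fun c₁ c₂ => u * (S c₁ * c₂) * S (b * d))
            (by fun_prop),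
          sw_antipode_mul hS c (fun u => εs k V a * u * S (b * d)) (by fun_prop), εs_mul hV]
    _ = sw (Δ x) fun a b => sw (Δ b) fun b₁ b₂ => sw (Δ y) fun c d => sw (Δ d) fun d₁ d₂ =>
          S a * b₁ * (S c * d₁) * S (b₂ * d₂) := by
        rw [sw_coassoc x (fun a b e => sw (Δ y) fun c d => sw (Δ c) fun c₁ c₂ =>
          S a * b * (S c₁ * c₂) * S (e * d)) (by fun_prop) (by fun_prop) (by fun_prop)]
        refine sw_congr _ fun a b => sw_congr _ fun b₁ b₂ => ?_
        exact sw_coassoc y (fun c d f => S a * b₁ * (S c * d) * S (b₂ * f)) (by fun_prop)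
          (by fun_prop) (by fun_prop)
    _ = sw (Δ x) fun a b => sw (Δ y) fun c d => S a * S c * εt k V (b * d) := by
        refine sw_congr _ fun a b => ?_
        rw [sw_swap]
        refine sw_congr _ fun c d => ?_
        rw [← sw_mul_antipode hS (b * d) (fun u => S a * S c * u) (by fun_prop),
          sw_comul_mul hV _ _ _ (by fun_prop) (by fun_prop)]
        refine sw_congr _ fun b₁ b₂ => sw_congr _ fun d₁ d₂ => ?_
        ring
    _ = sw (Δ x) fun a b => sw (Δ y) fun c d => S a * εt k V b * (S c * εt k V d) := by
        refine sw_congr _ fun a b => sw_congr _ fun c d => ?_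
        rw [εt_mul hV]
        ring
    _ = S x * S y := by
        rw [sw_antipode_mul_εt hS x (fun u => sw (Δ y) fun c d => u * (S c * εt k V d))
          (by fun_prop), sw_antipode_mul_εt hS y (fun u => S x * u) (by fun_prop)]

end CommutativeAntipode

/-! ### Comodule bialgebras -/

section Comodule

variable {k C H M : Type*} [Field k] [Ring C] [Algebra k C] [Coalgebra k C]
  [CommRing H] [Algebra k H] [Coalgebra k H] [AddCommGroup M] [Module k M]
  {ρ : C →ₗ[k] H ⊗[k] C}

local notation "Δ" => Coalgebra.comul (R := k)
local notation "ε" => Coalgebra.counit (R := k)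

theorem sw_counit_coact (hρ : IsComoduleBialgebra ρ) (c : C) (F : C → M) (h : Lin k F) :
    sw (ρ c) (fun q p => ε q • F p) = F c := by
  have := congrArg F (hρ.comoduleAlgebra.counit_coact c)
  simp (disch := fun_prop) only [lid_eq_sw, sw_rTensor, Lin.map_sw h, h.map_smul] at this
  exact this

theorem sw_coact_coact (hρ : IsComoduleBialgebra ρ) (c : C) (F : H → H → C → M)
    (h1 : ∀ b c, Lin k fun a => F a b c) (h2 : ∀ a c, Lin k fun b => F a b c)
    (h3 : ∀ a b, Lin k fun c => F a b c) :
    sw (ρ c) (fun q p => sw (ρ p) fun q' p' => F q q' p') =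
      sw (ρ c) fun q p => sw (Δ q) fun q₁ q₂ => F q₁ q₂ p := by
  have := congrArg (fun t => sw t fun a u => sw u fun b c => F a b c)
    (hρ.comoduleAlgebra.coact_coact c)
  simpa (disch := fun_prop) only [sw_assoc, sw_rTensor, sw_lTensor, sw_tmul] using this

theorem sw_comul_coact (hρ : IsComoduleBialgebra ρ) (c : C) (F : H → C → C → M)
    (h1 : ∀ b c, Lin k fun a => F a b c) (h2 : ∀ a c, Lin k fun b => F a b c)
    (h3 : ∀ a b, Lin k fun c => F a b c) :
    sw (ρ c) (fun q p => sw (Δ p) fun a b => F q a b) =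
      sw (Δ c) fun a b => sw (ρ a) fun q p => sw (ρ b) fun q' p' => F (q * q') p p' := by
  have := congrArg (fun t => sw t fun a u => sw u fun b c => F a b c)
    (hρ.comoduleCoalgebra.comul_coact c)
  simpa (disch := fun_prop) only [sw_assoc, sw_rTensor, sw_lTensor, sw_tmul, sw_map,
    sw_tensorTensorTensorComm, mul'_eq_sw] using this

theorem sw_coact_counit (hρ : IsComoduleBialgebra ρ) (c : C) (F : H → M) (h : Lin k F) :
    sw (ρ c) (fun q p => ε p • F (εt k H q)) = sw (ρ c) fun q p => ε p • F q := by
  have := congrArg (fun t => sw t fun a r => r • F a) (hρ.comoduleCoalgebra.coact_counit c)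
  simp (disch := fun_prop) only [sw_lTensor, sw_map] at this
  exact this.symm

theorem sw_coact_mul (hρ : IsComoduleBialgebra ρ) (c d : C) (F : H → C → M)
    (h1 : ∀ b, Lin k fun a => F a b) (h2 : ∀ a, Lin k fun b => F a b) :
    sw (ρ (c * d)) F = sw (ρ c) fun q p => sw (ρ d) fun q' p' => F (q * q') (p * p') := by
  rw [hρ.comoduleAlgebra.coact_mul, sw_mul _ _ _ h1 h2]

theorem sw_coact_one (hρ : IsComoduleBialgebra ρ) (F : H → C → M)
    (h1 : ∀ b, Lin k fun a => F a b) (h2 : ∀ a, Lin k fun b => F a b) :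
    sw (ρ 1) (fun q p => F (εs k H q) p) = sw (ρ 1) F := by
  rw [← sw_rTensor _ _ _ h1 h2, hρ.comoduleAlgebra.coact_one]

/-- `c⁰ ⊗ ε_t(c⁻¹) = 1⁰ c ⊗ ε_t(1⁻¹)` -/
theorem sw_coact_εt_left (hH : IsWeakBialg k H) (hρ : IsComoduleBialgebra ρ) (c : C)
    (F : H → C → M) (h1 : ∀ b, Lin k fun a => F a b) (h2 : ∀ a, Lin k fun b => F a b) :
    sw (ρ c) (fun q p => F (εt k H q) p) = sw (ρ 1) fun q p => F (εt k H q) (p * c) := by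
  calc sw (ρ c) (fun q p => F (εt k H q) p)
      = sw (ρ 1) fun q p => sw (ρ c) fun q' p' => F (εt k H (q * q')) (p * p') := by
        rw [← sw_coact_mul hρ _ _ (fun q p => F (εt k H q) p) (by fun_prop) (by fun_prop), one_mul]
    _ = sw (ρ 1) fun q p => sw (Δ q) fun q₁ q₂ => sw (ρ c) fun q' p' =>
          ε (q₂ * q') • F (εt k H q₁) (p * p') := by
        refine sw_congr _ fun q p => ?_
        rw [sw_swap]
        refine sw_congr _ fun q' p' => ?_
        rw [sw_counit_mul_εt hH q q' (fun u => F u (p * p')) (by fun_prop)]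
    _ = sw (ρ 1) fun q p => sw (ρ (p * c)) fun q' p' => ε q' • F (εt k H q) p' := by
        simp (disch := fun_prop) only [← sw_coact_coact hρ, sw_coact_mul hρ]
    _ = _ := by
        simp (disch := fun_prop) only [sw_counit_coact hρ]

/-- `c⁰ ⊗ ε_t(c⁻¹) = c 1⁰ ⊗ ε_t(1⁻¹)` -/
theorem sw_coact_εt_right (hH : IsWeakBialg k H) (hρ : IsComoduleBialgebra ρ) (c : C)
    (F : H → C → M) (h1 : ∀ b, Lin k fun a => F a b) (h2 : ∀ a, Lin k fun b => F a b) :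
    sw (ρ c) (fun q p => F (εt k H q) p) = sw (ρ 1) fun q p => F (εt k H q) (c * p) := by
  calc sw (ρ c) (fun q p => F (εt k H q) p)
      = sw (ρ 1) fun q p => sw (ρ c) fun q' p' => F (εt k H (q * q')) (p' * p) := by
        rw [sw_swap]
        simp only [mul_comm _ (_ : H)]
        rw [← sw_coact_mul hρ _ _ (fun q p => F (εt k H q) p) (by fun_prop) (by fun_prop), mul_one]
    _ = sw (ρ 1) fun q p => sw (Δ q) fun q₁ q₂ => sw (ρ c) fun q' p' =>
          ε (q₂ * q') • F (εt k H q₁) (p' * p) := by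
        refine sw_congr _ fun q p => ?_
        rw [sw_swap]
        refine sw_congr _ fun q' p' => ?_
        rw [sw_counit_mul_εt hH q q' (fun u => F u (p' * p)) (by fun_prop)]
    _ = sw (ρ 1) fun q p => sw (ρ p) fun q₂ p₂ => sw (ρ c) fun q' p' =>
          ε (q₂ * q') • F (εt k H q) (p' * p₂) :=
        (sw_coact_coact hρ 1 (fun a b e => sw (ρ c) fun q' p' =>
          ε (b * q') • F (εt k H a) (p' * e)) (by fun_prop) (by fun_prop) (by fun_prop)).symm
    _ = sw (ρ 1) fun q p => sw (ρ (c * p)) fun q' p' => ε q' • F (εt k H q) p' := by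
        simp (disch := fun_prop) only [sw_coact_mul hρ]
        refine sw_congr _ fun q p => ?_
        rw [sw_swap]
        simp only [mul_comm]
    _ = _ := by
        simp (disch := fun_prop) only [sw_counit_coact hρ]

/-- `(cd)⁰ ⊗ ε_t((cd)⁻¹) = c d⁰ ⊗ ε_t(d⁻¹)` -/
theorem sw_coact_mul_εt (hH : IsWeakBialg k H) (hρ : IsComoduleBialgebra ρ) (c d : C)
    (F : H → C → M) (h1 : ∀ b, Lin k fun a => F a b) (h2 : ∀ a, Lin k fun b => F a b) :
    sw (ρ (c * d)) (fun q p => F (εt k H q) p) = sw (ρ d) fun q p => F (εt k H q) (c * p) := by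
  rw [sw_coact_εt_right hH hρ (c * d) F h1 h2,
    sw_coact_εt_right hH hρ d (fun q p => F q (c * p)) (by fun_prop) (by fun_prop)]
  simp only [mul_assoc]

/-- `c⁰ ⊗ ε_t(c⁻¹₁) c⁻¹₂ = c⁰ ⊗ c⁻¹`, written with two coactions. -/
theorem sw_coact_εt_coact (hH : IsWeakBialg k H) (hρ : IsComoduleBialgebra ρ) (c : C)
    (F : H → C → M) (h1 : ∀ b, Lin k fun a => F a b) (h2 : ∀ a, Lin k fun b => F a b) :
    sw (ρ c) (fun q p => sw (ρ p) fun q' p' => F (εt k H q * q') p') = sw (ρ c) F := by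
  rw [sw_coact_coact hρ c (fun a b e => F (εt k H a * b) e) (by fun_prop) (by fun_prop)
    (by fun_prop)]
  refine sw_congr _ fun q p => ?_
  rw [sw_εt_mul hH q (fun u => F u p) (by fun_prop)]

end Comodule

/-! ### The structure maps on `C ⊗ H` -/

section SmashMaps

theorem twist_tmul {k C H : Type*} [Field k] [Ring C] [Algebra k C] [CommRing H] [Algebra k H]
    {ρ : C →ₗ[k] H ⊗[k] C} (c : C) (h : H) :
    twist ρ (c ⊗ₜ[k] h) = sw (ρ c) fun q p => p ⊗ₜ[k] (q * h) := by
  rw [← sw_tmul_eq (twist ρ (c ⊗ₜ[k] h))]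
  simp (disch := fun_prop) only [twist, LinearMap.comp_apply, LinearEquiv.coe_coe, sw_lTensor,
    LinearMap.rTensor_tmul, sw_assoc, sw_tmul, sw_comm, mul'_eq_sw]

variable {k C H M : Type*} [Field k] [Ring C] [Algebra k C] [Coalgebra k C]
  [CommRing H] [Algebra k H] [Coalgebra k H] [AddCommGroup M] [Module k M]
  {ρ : C →ₗ[k] H ⊗[k] C}

local notation "Δ" => Coalgebra.comul (R := k)
local notation "ε" => Coalgebra.counit (R := k)

theorem smashAntipode_tmul {k C H : Type*} [Field k] [Ring C] [Algebra k C] [CommRing H]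
    [Algebra k H] {ρ : C →ₗ[k] H ⊗[k] C} (SC : C →ₗ[k] C) (SH : H →ₗ[k] H) (c : C) (h : H) :
    smashAntipode ρ SC SH (c ⊗ₜ[k] h) = sw (ρ c) fun q p => SC p ⊗ₜ[k] SH (q * h) := by
  rw [smashAntipode, LinearMap.comp_apply, twist_tmul, map_sw]
  rfl

/-- The element `E = 1⁰ ⊗ ε_t(1⁻¹)` of the algebra `C ⊗ H`. It is a central idempotent, and the
projection `c ⊗ h ↦ c × h` is multiplication by `E`. -/
def smashUnit (ρ : C →ₗ[k] H ⊗[k] C) : C ⊗[k] H := sw (ρ 1) fun q p => p ⊗ₜ[k] εt k H q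

theorem smashUnit_mul_tmul (hH : IsWeakBialg k H) (hρ : IsComoduleBialgebra ρ) (c : C) (h : H) :
    smashUnit ρ * c ⊗ₜ[k] h = sw (ρ c) fun q p => p ⊗ₜ[k] (εt k H q * h) := by
  rw [sw_coact_εt_left hH hρ c (fun q p => p ⊗ₜ[k] (q * h)) (by fun_prop) (by fun_prop), smashUnit,
    Lin.map_sw (k := k) (G := fun u => u * c ⊗ₜ[k] h) (by fun_prop)]
  simp only [Algebra.TensorProduct.tmul_mul_tmul]

theorem tmul_mul_smashUnit (hH : IsWeakBialg k H) (hρ : IsComoduleBialgebra ρ) (c : C) (h : H) :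
    c ⊗ₜ[k] h * smashUnit ρ = sw (ρ c) fun q p => p ⊗ₜ[k] (εt k H q * h) := by
  rw [sw_coact_εt_right hH hρ c (fun q p => p ⊗ₜ[k] (q * h)) (by fun_prop) (by fun_prop),
    smashUnit, Lin.map_sw (k := k) (G := fun u => c ⊗ₜ[k] h * u) (by fun_prop)]
  simp only [Algebra.TensorProduct.tmul_mul_tmul, mul_comm h]

theorem smashUnit_mul_comm (hH : IsWeakBialg k H) (hρ : IsComoduleBialgebra ρ) (x : C ⊗[k] H) :
    smashUnit ρ * x = x * smashUnit ρ := by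
  refine Lin.ext_tmul (k := k) (f := fun x => smashUnit ρ * x) (g := fun x => x * smashUnit ρ)
    (by fun_prop) (by fun_prop) (fun c h => ?_) x
  rw [smashUnit_mul_tmul hH hρ, tmul_mul_smashUnit hH hρ]

theorem smashMap_eq (hH : IsWeakBialg k H) (hρ : IsComoduleBialgebra ρ) (x : C ⊗[k] H) :
    smashMap ρ x = smashUnit ρ * x := by
  refine Lin.ext_tmul (k := k) (f := fun x => smashMap ρ x) (g := fun x => smashUnit ρ * x)
    (by fun_prop) (by fun_prop) (fun c h => ?_) x
  rw [smashUnit_mul_tmul hH hρ]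
  simp (disch := fun_prop) only [smashMap, LinearMap.comp_apply, LinearEquiv.coe_coe, lid_eq_sw,
    sw_rTensor, sw_tensorTensorTensorComm, TensorProduct.map_tmul, sw_tmul, mul'_eq_sw]
  refine sw_congr _ fun q p => ?_
  simp only [mul_comm q]
  rw [sw_counit_mul_smul hH h q (fun u => p ⊗ₜ[k] u) (by fun_prop), mul_comm]

theorem smashUnit_mul_smashUnit (hH : IsWeakBialg k H) (hρ : IsComoduleBialgebra ρ) :
    smashUnit ρ * smashUnit ρ = smashUnit ρ := by
  have h : sw (ρ (1 * 1)) (fun q p => p ⊗ₜ[k] εt k H q) = smashUnit ρ := by rw [mul_one, smashUnit]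
  rw [sw_coact_mul hρ _ _ _ (by fun_prop) (by fun_prop)] at h
  conv_rhs => rw [← h]
  rw [smashUnit, Lin.map_sw (k := k)
    (G := fun u => u * sw (ρ 1) fun q p => p ⊗ₜ[k] εt k H q) (by fun_prop)]
  refine sw_congr _ fun q p => ?_
  rw [Lin.map_sw (k := k) (G := fun u => p ⊗ₜ[k] εt k H q * u) (by fun_prop)]
  simp only [Algebra.TensorProduct.tmul_mul_tmul, εt_mul hH]

theorem map_smashUnit_mul_tmul (hH : IsWeakBialg k H) (hρ : IsComoduleBialgebra ρ)
    {F : C ⊗[k] H → M} (hF : Lin k F) (c : C) (h : H) :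
    F (smashUnit ρ * c ⊗ₜ[k] h) = sw (ρ c) fun q p => F (p ⊗ₜ[k] (εt k H q * h)) := by
  rw [smashUnit_mul_tmul hH hρ, hF.map_sw]

theorem toSmash_surjective {k C H : Type*} [Field k] [Ring C] [Algebra k C] [CommRing H]
    [Algebra k H] [Coalgebra k H] (ρ : C →ₗ[k] H ⊗[k] C) : Function.Surjective (toSmash ρ) := by
  rintro ⟨x, hx⟩
  have h : smash ρ ≤ LinearMap.range (smashMap ρ) :=
    Submodule.span_le.2 (by rintro _ ⟨p, rfl⟩; exact ⟨_, rfl⟩)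
  obtain ⟨y, rfl⟩ := h hx
  exact ⟨y, rfl⟩

theorem toSmash_smashUnit_mul (hH : IsWeakBialg k H) (hρ : IsComoduleBialgebra ρ) (x : C ⊗[k] H) :
    toSmash ρ (smashUnit ρ * x) = toSmash ρ x := by
  refine Subtype.ext ?_
  change smashMap ρ (smashUnit ρ * x) = smashMap ρ x
  rw [smashMap_eq hH hρ, smashMap_eq hH hρ, ← mul_assoc, smashUnit_mul_smashUnit hH hρ]

theorem twist_smashUnit_mul (hH : IsWeakBialg k H) (hρ : IsComoduleBialgebra ρ) (x : C ⊗[k] H) :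
    twist ρ (smashUnit ρ * x) = twist ρ x := by
  refine Lin.ext_tmul (k := k) (f := fun x => twist ρ (smashUnit ρ * x)) (g := fun x => twist ρ x)
    (by fun_prop) (by fun_prop) (fun c h => ?_) x
  rw [smashUnit_mul_tmul hH hρ, Lin.map_sw (G := fun u => twist ρ u) (by fun_prop)]
  simp only [twist_tmul]
  rw [← sw_coact_εt_coact hH hρ c (fun q p => p ⊗ₜ[k] (q * h)) (by fun_prop) (by fun_prop)]
  refine sw_congr _ fun q p => sw_congr _ fun q' p' => ?_
  rw [mul_left_comm, mul_assoc]

theorem smashCounit_tmul (c : C) (h : H) :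
    smashCounit ρ (c ⊗ₜ[k] h) = sw (ρ c) fun q p => ε p • ε (q * h) := by
  rw [smashCounit, LinearMap.comp_apply, LinearMap.comp_apply, twist_tmul, Lin.map_sw
    (G := fun u => LinearMap.mul' k k (TensorProduct.map ε ε u)) (by fun_prop)]
  rfl

theorem sw_smashComul (c : C) (h : H) (F : C ⊗[k] H → C ⊗[k] H → M)
    (h1 : ∀ b, Lin k fun a => F a b) (h2 : ∀ a, Lin k fun b => F a b) :
    sw (smashComul ρ (c ⊗ₜ[k] h)) F = sw (Δ c) fun c₁ c₂ => sw (ρ c₂) fun q p =>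
      sw (Δ h) fun h₁ h₂ => F (c₁ ⊗ₜ[k] (q * h₁)) (p ⊗ₜ[k] h₂) := by
  simp (disch := fun_prop) only [smashComul, LinearMap.comp_apply, LinearEquiv.coe_coe, sw_rTensor,
    TensorProduct.map_tmul, sw_assoc_symm, sw_tmul, sw_tensorTensorTensorComm, sw_lTensor]
  refine sw_congr _ fun c₁ c₂ => sw_congr _ fun q p => sw_congr _ fun h₁ h₂ => ?_
  simp only [TensorProduct.assoc_tmul, LinearMap.lTensor_tmul, LinearMap.mul'_apply]

/-- `Δ'(E x) = (E ⊗ 1) Δ'(x)`. The factor `E` splits by the comodule coalgebra axiom into a copy for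
each leg of `Δ(c)`; the second copy is absorbed by the coaction on that leg. -/
theorem sw_smashComul_smashUnit_mul (hH : IsWeakBialg k H) (hρ : IsComoduleBialgebra ρ)
    (x : C ⊗[k] H) (F : C ⊗[k] H → C ⊗[k] H → M)
    (h1 : ∀ b, Lin k fun a => F a b) (h2 : ∀ a, Lin k fun b => F a b) :
    sw (smashComul ρ (smashUnit ρ * x)) F =
      sw (smashComul ρ x) fun a b => F (smashUnit ρ * a) b := by
  refine Lin.ext_tmul (k := k) (f := fun x => sw (smashComul ρ (smashUnit ρ * x)) F)
    (g := fun x => sw (smashComul ρ x) fun a b => F (smashUnit ρ * a) b)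
    (by fun_prop) (by fun_prop) (fun c h => ?_) x
  rw [smashUnit_mul_tmul hH hρ, Lin.map_sw (G := fun u => sw (smashComul ρ u) F) (by fun_prop)]
  simp (disch := fun_prop) only [sw_smashComul, sw_comul_εt_mul hH]
  calc sw (ρ c) (fun q p => sw (Δ p) fun c₁ c₂ => sw (ρ c₂) fun q' p' => sw (Δ h) fun h₁ h₂ =>
          F (c₁ ⊗ₜ[k] (q' * (εt k H q * h₁))) (p' ⊗ₜ[k] h₂))
      = sw (Δ c) fun c₁ c₂ => sw (ρ c₁) fun q p => sw (ρ c₂) fun q' p' => sw (ρ p') fun q'' p'' =>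
          sw (Δ h) fun h₁ h₂ =>
          F (p ⊗ₜ[k] (εt k H q' * q'' * (εt k H q * h₁))) (p'' ⊗ₜ[k] h₂) := by
        rw [sw_comul_coact hρ c (fun q c₁ c₂ => sw (ρ c₂) fun q' p' => sw (Δ h) fun h₁ h₂ =>
          F (c₁ ⊗ₜ[k] (q' * (εt k H q * h₁))) (p' ⊗ₜ[k] h₂)) (by fun_prop) (by fun_prop)
          (by fun_prop)]
        simp only [εt_mul hH, mul_comm, mul_left_comm]
    _ = sw (Δ c) fun c₁ c₂ => sw (ρ c₂) fun q p => sw (Δ h) fun h₁ h₂ =>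
          F (smashUnit ρ * c₁ ⊗ₜ[k] (q * h₁)) (p ⊗ₜ[k] h₂) := by
        refine sw_congr _ fun c₁ c₂ => ?_
        have h' (q : H) (p : C) (h₁ h₂ : H) :
            F (smashUnit ρ * c₁ ⊗ₜ[k] (q * h₁)) (p ⊗ₜ[k] h₂) =
              sw (ρ c₁) fun r s => F (s ⊗ₜ[k] (q * (εt k H r * h₁))) (p ⊗ₜ[k] h₂) := by
          rw [map_smashUnit_mul_tmul hH hρ (F := fun u => F u (p ⊗ₜ[k] h₂)) (by fun_prop)]
          simp only [mul_left_comm]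
        simp only [h']
        simp only [sw_swap _ (ρ c₁)]
        refine sw_congr _ fun r s => ?_
        exact sw_coact_εt_coact hH hρ c₂ (fun q p => sw (Δ h) fun h₁ h₂ =>
          F (s ⊗ₜ[k] (q * (εt k H r * h₁))) (p ⊗ₜ[k] h₂)) (by fun_prop) (by fun_prop)

/-- `Δ'` is multiplicative on `C ⊗ H`; this uses the commutativity of `H`. -/
theorem sw_smashComul_mul (hC : IsWeakBialg k C) (hH : IsWeakBialg k H)
    (hρ : IsComoduleBialgebra ρ) (x y : C ⊗[k] H) (F : C ⊗[k] H → C ⊗[k] H → M)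
    (h1 : ∀ b, Lin k fun a => F a b) (h2 : ∀ a, Lin k fun b => F a b) :
    sw (smashComul ρ (x * y)) F =
      sw (smashComul ρ x) fun a b => sw (smashComul ρ y) fun c d => F (a * c) (b * d) := by
  refine Lin.ext_tmul (k := k) (f := fun x => sw (smashComul ρ (x * y)) F)
    (g := fun x => sw (smashComul ρ x) fun a b => sw (smashComul ρ y) fun c d => F (a * c) (b * d))
    (by fun_prop) (by fun_prop) (fun c h => ?_) x
  refine Lin.ext_tmul (k := k) (f := fun y => sw (smashComul ρ (c ⊗ₜ[k] h * y)) F)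
    (g := fun y => sw (smashComul ρ (c ⊗ₜ[k] h)) fun a b =>
      sw (smashComul ρ y) fun c d => F (a * c) (b * d)) (by fun_prop) (by fun_prop)
    (fun d l => ?_) y
  simp (disch := fun_prop) only [Algebra.TensorProduct.tmul_mul_tmul, sw_smashComul,
    sw_comul_mul hC, sw_comul_mul hH, sw_coact_mul hρ]
  simp only [sw_swap _ (Δ d)]
  refine sw_congr _ fun c₁ c₂ => sw_congr _ fun d₁ d₂ => sw_congr _ fun q p => ?_
  rw [sw_swap]
  simp only [mul_mul_mul_comm]

/-- `Δ'` is coassociative on `C ⊗ H`. Both sides expand to sums over `c₁ ⊗ c₂ ⊗ c₃` and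
`h₁ ⊗ h₂ ⊗ h₃`, in which the comodule coalgebra axiom spreads the coaction over `c₂` and `c₃`. -/
theorem sw_smashComul_coassoc (hH : IsWeakBialg k H)
    (hρ : IsComoduleBialgebra ρ) (x : C ⊗[k] H) (F : C ⊗[k] H → C ⊗[k] H → C ⊗[k] H → M)
    (h1 : ∀ b c, Lin k fun a => F a b c) (h2 : ∀ a c, Lin k fun b => F a b c)
    (h3 : ∀ a b, Lin k fun c => F a b c) :
    sw (smashComul ρ x) (fun a b => sw (smashComul ρ a) fun c d => F c d b) =
      sw (smashComul ρ x) fun a b => sw (smashComul ρ b) fun c d => F a c d := by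
  refine Lin.ext_tmul (k := k)
    (f := fun x => sw (smashComul ρ x) fun a b => sw (smashComul ρ a) fun c d => F c d b)
    (g := fun x => sw (smashComul ρ x) fun a b => sw (smashComul ρ b) fun c d => F a c d)
    (by fun_prop) (by fun_prop) (fun c h => ?_) x
  simp (disch := fun_prop) only [sw_smashComul, sw_comul_mul hH]
  calc sw (Δ c) (fun c₁ c₂ => sw (ρ c₂) fun q p => sw (Δ h) fun h₁ h₂ => sw (Δ c₁) fun c₃ c₄ =>
          sw (ρ c₄) fun q' p' => sw (Δ q) fun q₁ q₂ => sw (Δ h₁) fun h₃ h₄ =>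
          F (c₃ ⊗ₜ[k] (q' * (q₁ * h₃))) (p' ⊗ₜ[k] (q₂ * h₄)) (p ⊗ₜ[k] h₂))
      = sw (Δ c) fun c₁ c₂ => sw (Δ c₁) fun c₃ c₄ => sw (ρ c₄) fun q' p' => sw (ρ c₂) fun q p =>
          sw (Δ q) fun q₁ q₂ => sw (Δ h) fun h₁ h₂ => sw (Δ h₁) fun h₃ h₄ =>
          F (c₃ ⊗ₜ[k] (q' * (q₁ * h₃))) (p' ⊗ₜ[k] (q₂ * h₄)) (p ⊗ₜ[k] h₂) := by
        refine sw_congr _ fun c₁ c₂ => ?_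
        simp only [sw_swap _ (Δ c₁)]
        refine sw_congr _ fun c₃ c₄ => ?_
        simp only [sw_swap _ (ρ c₄)]
        refine sw_congr _ fun q' p' => sw_congr _ fun q p => sw_swap _ _ _
    _ = sw (Δ c) fun c₁ c₂ => sw (Δ c₂) fun c₃ c₄ => sw (ρ c₃) fun q' p' => sw (ρ c₄) fun q p =>
          sw (Δ q) fun q₁ q₂ => sw (Δ h) fun h₁ h₂ => sw (Δ h₂) fun h₃ h₄ =>
          F (c₁ ⊗ₜ[k] (q' * (q₁ * h₁))) (p' ⊗ₜ[k] (q₂ * h₃)) (p ⊗ₜ[k] h₄) := by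
        rw [sw_coassoc c (fun c₁ c₂ c₃ => sw (ρ c₂) fun q' p' => sw (ρ c₃) fun q p =>
          sw (Δ q) fun q₁ q₂ => sw (Δ h) fun h₁ h₂ => sw (Δ h₁) fun h₃ h₄ =>
          F (c₁ ⊗ₜ[k] (q' * (q₁ * h₃))) (p' ⊗ₜ[k] (q₂ * h₄)) (p ⊗ₜ[k] h₂)) (by fun_prop)
          (by fun_prop) (by fun_prop)]
        refine sw_congr _ fun c₁ c₂ => sw_congr _ fun c₃ c₄ => sw_congr _ fun q' p' =>
          sw_congr _ fun q p => sw_congr _ fun q₁ q₂ => ?_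
        exact sw_coassoc h (fun h₁ h₂ h₃ => F (c₁ ⊗ₜ[k] (q' * (q₁ * h₁))) (p' ⊗ₜ[k] (q₂ * h₂))
          (p ⊗ₜ[k] h₃)) (by fun_prop) (by fun_prop) (by fun_prop)
    _ = sw (Δ c) fun c₁ c₂ => sw (Δ c₂) fun c₃ c₄ => sw (ρ c₃) fun q' p' => sw (ρ c₄) fun q p =>
          sw (ρ p) fun q₂ p₂ => sw (Δ h) fun h₁ h₂ => sw (Δ h₂) fun h₃ h₄ =>
          F (c₁ ⊗ₜ[k] (q' * q * h₁)) (p' ⊗ₜ[k] (q₂ * h₃)) (p₂ ⊗ₜ[k] h₄) := by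
        refine sw_congr _ fun c₁ c₂ => sw_congr _ fun c₃ c₄ => sw_congr _ fun q' p' => ?_
        simp only [mul_assoc]
        exact (sw_coact_coact hρ c₄ (fun q q₂ p => sw (Δ h) fun h₁ h₂ => sw (Δ h₂) fun h₃ h₄ =>
          F (c₁ ⊗ₜ[k] (q' * (q * h₁))) (p' ⊗ₜ[k] (q₂ * h₃)) (p ⊗ₜ[k] h₄)) (by fun_prop)
          (by fun_prop) (by fun_prop)).symm
    _ = sw (Δ c) fun c₁ c₂ => sw (ρ c₂) fun q p => sw (Δ p) fun p₁ p₂ => sw (ρ p₂) fun q' p' =>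
          sw (Δ h) fun h₁ h₂ => sw (Δ h₂) fun h₃ h₄ =>
          F (c₁ ⊗ₜ[k] (q * h₁)) (p₁ ⊗ₜ[k] (q' * h₃)) (p' ⊗ₜ[k] h₄) := by
        refine sw_congr _ fun c₁ c₂ => ?_
        exact (sw_comul_coact hρ c₂ (fun q p₁ p₂ => sw (ρ p₂) fun q' p' =>
          sw (Δ h) fun h₁ h₂ => sw (Δ h₂) fun h₃ h₄ =>
          F (c₁ ⊗ₜ[k] (q * h₁)) (p₁ ⊗ₜ[k] (q' * h₃)) (p' ⊗ₜ[k] h₄)) (by fun_prop)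
          (by fun_prop) (by fun_prop)).symm
    _ = _ := by
        refine sw_congr _ fun c₁ c₂ => sw_congr _ fun q p => ?_
        simp only [sw_swap _ (Δ h)]

end SmashMaps

/-! ### Counit and twist on `C ⊗ H` -/

section SmashAxioms

variable {k C H M : Type*} [Field k] [Ring C] [Algebra k C] [Coalgebra k C]
  [CommRing H] [Algebra k H] [Coalgebra k H] [AddCommGroup M] [Module k M]
  {ρ : C →ₗ[k] H ⊗[k] C}

local notation "Δ" => Coalgebra.comul (R := k)
local notation "ε" => Coalgebra.counit (R := k)

/-- `ε'(x₁) x₂ = E x` -/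
theorem sw_smashCounit_left (hH : IsWeakBialg k H) (hρ : IsComoduleBialgebra ρ)
    (x : C ⊗[k] H) (F : C ⊗[k] H → M) (hF : Lin k F) :
    sw (smashComul ρ x) (fun a b => smashCounit ρ a • F b) = F (smashUnit ρ * x) := by
  refine Lin.ext_tmul (k := k)
    (f := fun x => sw (smashComul ρ x) fun a b => smashCounit ρ a • F b)
    (g := fun x => F (smashUnit ρ * x)) (by fun_prop) (by fun_prop) (fun c h => ?_) x
  simp (disch := fun_prop) only [sw_smashComul, smashCounit_tmul]
  calc sw (Δ c) (fun c₁ c₂ => sw (ρ c₂) fun q p => sw (Δ h) fun h₁ h₂ =>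
          sw (ρ c₁) (fun r s => ε s • ε (r * (q * h₁))) • F (p ⊗ₜ[k] h₂))
      = sw (Δ c) fun c₁ c₂ => sw (ρ c₁) fun r s => sw (ρ c₂) fun q p => sw (Δ h) fun h₁ h₂ =>
          ε s • ε (h₁ * (r * q)) • F (p ⊗ₜ[k] h₂) := by
        refine sw_congr _ fun c₁ c₂ => ?_
        have h' (q h₁ : H) (m : M) : sw (ρ c₁) (fun r s => ε s • ε (r * (q * h₁))) • m =
            sw (ρ c₁) fun r s => ε s • ε (h₁ * (r * q)) • m := by
          rw [Lin.map_sw (G := fun r : k => r • m) (by fun_prop)]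
          simp only [smul_assoc, mul_comm h₁, mul_assoc]
        simp only [h']
        simp only [sw_swap _ (ρ c₁)]
    _ = sw (ρ c) fun q p => sw (Δ p) fun p₁ p₂ => ε p₁ • F (p₂ ⊗ₜ[k] (h * εt k H q)) := by
        rw [sw_comul_coact hρ c (fun q p₁ p₂ => ε p₁ • F (p₂ ⊗ₜ[k] (h * εt k H q))) (by fun_prop)
          (by fun_prop) (by fun_prop)]
        refine sw_congr _ fun c₁ c₂ => sw_congr _ fun r s => sw_congr _ fun q p => ?_
        rw [← sw_counit_mul_smul hH h (r * q) (fun u => ε s • F (p ⊗ₜ[k] u)) (by fun_prop)]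
        simp only [smul_comm (ε s)]
    _ = F (smashUnit ρ * c ⊗ₜ[k] h) := by
        rw [map_smashUnit_mul_tmul hH hρ hF]
        refine sw_congr _ fun q p => ?_
        rw [sw_counit_left p (fun u => F (u ⊗ₜ[k] (h * εt k H q))) (by fun_prop), mul_comm]

/-- `x₁ ε'(x₂) = x` modulo `E` -/
theorem sw_smashCounit_right (hH : IsWeakBialg k H) (hρ : IsComoduleBialgebra ρ)
    (x : C ⊗[k] H) (F : C ⊗[k] H → M) (hF : Lin k F) (hE : ∀ x, F (smashUnit ρ * x) = F x) :
    sw (smashComul ρ x) (fun a b => smashCounit ρ b • F a) = F x := by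
  refine Lin.ext_tmul (k := k)
    (f := fun x => sw (smashComul ρ x) fun a b => smashCounit ρ b • F a)
    (g := fun x => F x) (by fun_prop) (by fun_prop) (fun c h => ?_) x
  simp (disch := fun_prop) only [sw_smashComul, smashCounit_tmul]
  calc sw (Δ c) (fun c₁ c₂ => sw (ρ c₂) fun q p => sw (Δ h) fun h₁ h₂ =>
          sw (ρ p) (fun r s => ε s • ε (r * h₂)) • F (c₁ ⊗ₜ[k] (q * h₁)))
      = sw (Δ c) fun c₁ c₂ => sw (ρ c₂) fun q p => sw (ρ p) fun r s => sw (Δ h) fun h₁ h₂ =>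
          ε s • ε (r * h₂) • F (c₁ ⊗ₜ[k] (q * h₁)) := by
        refine sw_congr _ fun c₁ c₂ => sw_congr _ fun q p => ?_
        have h' (h₂ : H) (m : M) : sw (ρ p) (fun r s => ε s • ε (r * h₂)) • m =
            sw (ρ p) fun r s => ε s • ε (r * h₂) • m := by
          rw [Lin.map_sw (G := fun r : k => r • m) (by fun_prop)]
          simp only [smul_assoc]
        simp only [h']
        rw [sw_swap]
    _ = sw (Δ c) fun c₁ c₂ => sw (ρ c₂) fun q p => sw (Δ q) fun q₁ q₂ => sw (Δ h) fun h₁ h₂ =>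
          ε p • ε (q₂ * h₂) • F (c₁ ⊗ₜ[k] (q₁ * h₁)) := by
        refine sw_congr _ fun c₁ c₂ => ?_
        exact sw_coact_coact hρ c₂ (fun q r s => sw (Δ h) fun h₁ h₂ =>
          ε s • ε (r * h₂) • F (c₁ ⊗ₜ[k] (q * h₁))) (by fun_prop) (by fun_prop) (by fun_prop)
    _ = sw (Δ c) fun c₁ c₂ => sw (ρ c₂) fun q p => ε p • F (c₁ ⊗ₜ[k] (q * h)) := by
        refine sw_congr _ fun c₁ c₂ => sw_congr _ fun q p => ?_
        rw [← sw_comul_mul hH q h (fun a b => ε p • ε b • F (c₁ ⊗ₜ[k] a)) (by fun_prop)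
          (by fun_prop)]
        simp only [smul_comm (ε p)]
        exact sw_counit_right (q * h) (fun u => ε p • F (c₁ ⊗ₜ[k] u)) (by fun_prop)
    _ = sw (Δ c) fun c₁ c₂ => sw (ρ c₂) fun q p => ε p • sw (ρ c₁) fun r s =>
          F (s ⊗ₜ[k] (εt k H r * (εt k H q * h))) := by
        refine sw_congr _ fun c₁ c₂ => ?_
        rw [← sw_coact_counit hρ c₂ (fun q => F (c₁ ⊗ₜ[k] (q * h))) (by fun_prop)]
        simp only [← map_smashUnit_mul_tmul hH hρ hF, hE]
    _ = sw (ρ c) fun q p => sw (Δ p) fun p₁ p₂ => ε p₂ • F (p₁ ⊗ₜ[k] (εt k H q * h)) := by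
        rw [sw_comul_coact hρ c (fun q p₁ p₂ => ε p₂ • F (p₁ ⊗ₜ[k] (εt k H q * h))) (by fun_prop)
          (by fun_prop) (by fun_prop)]
        refine sw_congr _ fun c₁ c₂ => ?_
        simp only [smul_sw]
        rw [sw_swap]
        simp only [εt_mul hH, mul_assoc]
    _ = F (c ⊗ₜ[k] h) := by
        rw [← hE, map_smashUnit_mul_tmul hH hρ hF]
        refine sw_congr _ fun q p => ?_
        rw [sw_counit_right p (fun u => F (u ⊗ₜ[k] (εt k H q * h))) (by fun_prop)]

theorem twist_mul (hρ : IsComoduleBialgebra ρ) (x y : C ⊗[k] H) :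
    twist ρ (x * y) = twist ρ x * twist ρ y := by
  refine Lin.ext_tmul (k := k) (f := fun x => twist ρ (x * y))
    (g := fun x => twist ρ x * twist ρ y) (by fun_prop) (by fun_prop) (fun c h => ?_) x
  refine Lin.ext_tmul (k := k) (f := fun y => twist ρ (c ⊗ₜ[k] h * y))
    (g := fun y => twist ρ (c ⊗ₜ[k] h) * twist ρ y) (by fun_prop) (by fun_prop) (fun d l => ?_) y
  simp only [Algebra.TensorProduct.tmul_mul_tmul, twist_tmul]
  rw [sw_coact_mul hρ _ _ _ (by fun_prop) (by fun_prop),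
    Lin.map_sw (k := k) (G := fun u => u * sw (ρ d) fun q p => p ⊗ₜ[k] (q * l)) (by fun_prop)]
  refine sw_congr _ fun q p => ?_
  rw [Lin.map_sw (k := k) (G := fun u => p ⊗ₜ[k] (q * h) * u) (by fun_prop)]
  simp only [Algebra.TensorProduct.tmul_mul_tmul, mul_mul_mul_comm]

/-- The linear functional `ε_C ⊗ ε_H` on `C ⊗ H`. -/
def tensorCounit : C ⊗[k] H →ₗ[k] k :=
  LinearMap.mul' k k ∘ₗ TensorProduct.map (Coalgebra.counit (R := k)) (Coalgebra.counit (R := k))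

theorem tensorCounit_tmul (c : C) (h : H) : tensorCounit (c ⊗ₜ[k] h) = ε c • ε h := rfl

theorem smashCounit_apply (x : C ⊗[k] H) : smashCounit ρ x = tensorCounit (twist ρ x) := rfl

end SmashAxioms

/-! ### Weak multiplicativity of the counit -/

section SmashCounitMul

variable {k C H : Type*} [Field k] [Ring C] [Algebra k C] [Coalgebra k C]
  [CommRing H] [Algebra k H] [Coalgebra k H] {ρ : C →ₗ[k] H ⊗[k] C}

local notation "Δ" => Coalgebra.comul (R := k)
local notation "ε" => Coalgebra.counit (R := k)

theorem tensorCounit_mul_twist (p c : C) (q h : H) (m : k) :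
    tensorCounit (p ⊗ₜ[k] q * twist ρ (c ⊗ₜ[k] h)) • m =
      sw (ρ c) fun r u => ε (p * u) • ε (q * (r * h)) • m := by
  rw [twist_tmul, Lin.map_sw (k := k) (G := fun v => tensorCounit (p ⊗ₜ[k] q * v) • m)
    (by fun_prop)]
  simp only [Algebra.TensorProduct.tmul_mul_tmul, tensorCounit_tmul, smul_assoc]

theorem tensorCounit_twist_mul (p c : C) (q h : H) (m : k) :
    tensorCounit (twist ρ (c ⊗ₜ[k] h) * p ⊗ₜ[k] q) • m =
      sw (ρ c) fun r u => ε (u * p) • ε (r * h * q) • m := by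
  rw [twist_tmul, Lin.map_sw (k := k) (G := fun v => tensorCounit (v * p ⊗ₜ[k] q) • m)
    (by fun_prop)]
  simp only [Algebra.TensorProduct.tmul_mul_tmul, tensorCounit_tmul, smul_assoc]

theorem tensorCounit_mul_twist_mul (p p' c : C) (q q' h : H) (m : k) :
    tensorCounit (p ⊗ₜ[k] q * twist ρ (c ⊗ₜ[k] h) * p' ⊗ₜ[k] q') • m =
      sw (ρ c) fun r u => ε (p * u * p') • ε (q * (r * h) * q') • m := by
  rw [twist_tmul, Lin.map_sw (k := k)
    (G := fun v => tensorCounit (p ⊗ₜ[k] q * v * p' ⊗ₜ[k] q') • m) (by fun_prop)]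
  simp only [Algebra.TensorProduct.tmul_mul_tmul, tensorCounit_tmul, smul_assoc]

/-- The twist turns the first weak multiplicativity of `ε'` into those of `ε_C` and `ε_H`. -/
theorem sw_tensorCounit_mul_left (hC : IsWeakBialg k C) (hH : IsWeakBialg k H)
    (hρ : IsComoduleBialgebra ρ) (s y t : C ⊗[k] H) (m : k) :
    sw (smashComul ρ y)
      (fun a b => tensorCounit (s * twist ρ a) • tensorCounit (twist ρ b * t) • m) =
      tensorCounit (s * twist ρ y * t) • m := by
  refine Lin.ext_tmul (k := k)
    (f := fun s => sw (smashComul ρ y)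
      fun a b => tensorCounit (s * twist ρ a) • tensorCounit (twist ρ b * t) • m)
    (g := fun s => tensorCounit (s * twist ρ y * t) • m) (by fun_prop) (by fun_prop)
    (fun p q => ?_) s
  refine Lin.ext_tmul (k := k)
    (f := fun t => sw (smashComul ρ y)
      fun a b => tensorCounit (p ⊗ₜ[k] q * twist ρ a) • tensorCounit (twist ρ b * t) • m)
    (g := fun t => tensorCounit (p ⊗ₜ[k] q * twist ρ y * t) • m) (by fun_prop) (by fun_prop)
    (fun p' q' => ?_) t
  refine Lin.ext_tmul (k := k)
    (f := fun y => sw (smashComul ρ y) fun a b =>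
      tensorCounit (p ⊗ₜ[k] q * twist ρ a) • tensorCounit (twist ρ b * p' ⊗ₜ[k] q') • m)
    (g := fun y => tensorCounit (p ⊗ₜ[k] q * twist ρ y * p' ⊗ₜ[k] q') • m) (by fun_prop)
    (by fun_prop) (fun c h => ?_) y
  rw [sw_smashComul _ _ _ (by fun_prop) (by fun_prop)]
  simp only [tensorCounit_mul_twist, tensorCounit_twist_mul, tensorCounit_mul_twist_mul, smul_sw]
  calc sw (Δ c) (fun c₁ c₂ => sw (ρ c₂) fun r u => sw (Δ h) fun h₁ h₂ => sw (ρ u) fun r₂ u₂ =>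
          sw (ρ c₁) fun r₁ u₁ => ε (p * u₁) • ε (q * (r₁ * (r * h₁))) •
            ε (u₂ * p') • ε (r₂ * h₂ * q') • m)
      = sw (Δ c) fun c₁ c₂ => sw (ρ c₁) fun r₁ u₁ => sw (ρ c₂) fun r u => sw (ρ u) fun r₂ u₂ =>
          sw (Δ h) fun h₁ h₂ => ε (p * u₁) • ε (q * (r₁ * (r * h₁))) •
            ε (u₂ * p') • ε (r₂ * h₂ * q') • m := by
        refine sw_congr _ fun c₁ c₂ => ?_
        simp only [sw_swap _ (ρ c₁)]
        refine sw_congr _ fun r₁ u₁ => sw_congr _ fun r u => ?_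
        rw [sw_swap]
    _ = sw (Δ c) fun c₁ c₂ => sw (ρ c₁) fun r₁ u₁ => sw (ρ c₂) fun r u => sw (Δ r) fun r₂ r₃ =>
          sw (Δ h) fun h₁ h₂ => ε (p * u₁) • ε (q * (r₁ * (r₂ * h₁))) •
            ε (u * p') • ε (r₃ * h₂ * q') • m := by
        refine sw_congr _ fun c₁ c₂ => sw_congr _ fun r₁ u₁ => ?_
        exact sw_coact_coact hρ c₂ (fun r r₂ u => sw (Δ h) fun h₁ h₂ =>
          ε (p * u₁) • ε (q * (r₁ * (r * h₁))) • ε (u * p') • ε (r₂ * h₂ * q') • m)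
          (by fun_prop) (by fun_prop) (by fun_prop)
    _ = sw (Δ c) fun c₁ c₂ => sw (ρ c₁) fun r₁ u₁ => sw (ρ c₂) fun r u =>
          ε (p * u₁) • ε (u * p') • ε (q * (r₁ * r * h) * q') • m := by
        refine sw_congr _ fun c₁ c₂ => sw_congr _ fun r₁ u₁ => sw_congr _ fun r u => ?_
        rw [← sw_comul_mul hH r h (fun a b => ε (p * u₁) • ε (q * (r₁ * a)) •
          ε (u * p') • ε (b * q') • m) (by fun_prop) (by fun_prop)]
        simp only [← mul_assoc, smul_comm (ε (_ * _) : k) (ε (u * p')), ← smul_sw]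
        rw [sw_counit_mul_left hH]
        simp only [mul_assoc]
    _ = sw (ρ c) fun r u => sw (Δ u) fun u₁ u₂ =>
          ε (p * u₁) • ε (u₂ * p') • ε (q * (r * h) * q') • m := by
        exact (sw_comul_coact hρ c (fun r u₁ u₂ => ε (p * u₁) • ε (u₂ * p') •
          ε (q * (r * h) * q') • m) (by fun_prop) (by fun_prop) (by fun_prop)).symm
    _ = _ := by
        simp only [sw_counit_mul_left hC]

/-- The twist turns the second weak multiplicativity of `ε'` into those of `ε_C` and `ε_H`. -/
theorem sw_tensorCounit_mul_right (hC : IsWeakBialg k C) (hH : IsWeakBialg k H)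
    (hρ : IsComoduleBialgebra ρ) (s y t : C ⊗[k] H) (m : k) :
    sw (smashComul ρ y)
      (fun a b => tensorCounit (s * twist ρ b) • tensorCounit (twist ρ a * t) • m) =
      tensorCounit (s * twist ρ y * t) • m := by
  refine Lin.ext_tmul (k := k)
    (f := fun s => sw (smashComul ρ y)
      fun a b => tensorCounit (s * twist ρ b) • tensorCounit (twist ρ a * t) • m)
    (g := fun s => tensorCounit (s * twist ρ y * t) • m) (by fun_prop) (by fun_prop)
    (fun p q => ?_) s
  refine Lin.ext_tmul (k := k)
    (f := fun t => sw (smashComul ρ y)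
      fun a b => tensorCounit (p ⊗ₜ[k] q * twist ρ b) • tensorCounit (twist ρ a * t) • m)
    (g := fun t => tensorCounit (p ⊗ₜ[k] q * twist ρ y * t) • m) (by fun_prop) (by fun_prop)
    (fun p' q' => ?_) t
  refine Lin.ext_tmul (k := k)
    (f := fun y => sw (smashComul ρ y) fun a b =>
      tensorCounit (p ⊗ₜ[k] q * twist ρ b) • tensorCounit (twist ρ a * p' ⊗ₜ[k] q') • m)
    (g := fun y => tensorCounit (p ⊗ₜ[k] q * twist ρ y * p' ⊗ₜ[k] q') • m) (by fun_prop)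
    (by fun_prop) (fun c h => ?_) y
  rw [sw_smashComul _ _ _ (by fun_prop) (by fun_prop)]
  simp only [tensorCounit_mul_twist, tensorCounit_twist_mul, tensorCounit_mul_twist_mul, smul_sw]
  calc sw (Δ c) (fun c₁ c₂ => sw (ρ c₂) fun r u => sw (Δ h) fun h₁ h₂ => sw (ρ c₁) fun r₁ u₁ =>
          sw (ρ u) fun r₂ u₂ => ε (p * u₂) • ε (q * (r₂ * h₂)) •
            ε (u₁ * p') • ε (r₁ * (r * h₁) * q') • m)
      = sw (Δ c) fun c₁ c₂ => sw (ρ c₁) fun r₁ u₁ => sw (ρ c₂) fun r u => sw (ρ u) fun r₂ u₂ =>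
          sw (Δ h) fun h₁ h₂ => ε (p * u₂) • ε (q * (r₂ * h₂)) •
            ε (u₁ * p') • ε (r₁ * (r * h₁) * q') • m := by
        refine sw_congr _ fun c₁ c₂ => ?_
        simp only [sw_swap _ (ρ c₁)]
        refine sw_congr _ fun r₁ u₁ => sw_congr _ fun r u => ?_
        rw [sw_swap]
    _ = sw (Δ c) fun c₁ c₂ => sw (ρ c₁) fun r₁ u₁ => sw (ρ c₂) fun r u => sw (Δ r) fun r₂ r₃ =>
          sw (Δ h) fun h₁ h₂ => ε (p * u) • ε (q * (r₃ * h₂)) •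
            ε (u₁ * p') • ε (r₁ * (r₂ * h₁) * q') • m := by
        refine sw_congr _ fun c₁ c₂ => sw_congr _ fun r₁ u₁ => ?_
        exact sw_coact_coact hρ c₂ (fun r r₂ u => sw (Δ h) fun h₁ h₂ =>
          ε (p * u) • ε (q * (r₂ * h₂)) • ε (u₁ * p') • ε (r₁ * (r * h₁) * q') • m)
          (by fun_prop) (by fun_prop) (by fun_prop)
    _ = sw (Δ c) fun c₁ c₂ => sw (ρ c₁) fun r₁ u₁ => sw (ρ c₂) fun r u =>
          ε (p * u) • ε (u₁ * p') • ε (q * (r₁ * r * h) * q') • m := by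
        refine sw_congr _ fun c₁ c₂ => sw_congr _ fun r₁ u₁ => sw_congr _ fun r u => ?_
        rw [← sw_comul_mul hH r h (fun a b => ε (p * u) • ε (q * b) •
          ε (u₁ * p') • ε (r₁ * a * q') • m) (by fun_prop) (by fun_prop)]
        simp only [mul_comm r₁, mul_assoc, smul_comm (ε (_ * _) : k) (ε (u₁ * p')), ← smul_sw]
        rw [sw_counit_mul_right hH]
        simp only [mul_assoc, mul_left_comm]
    _ = sw (ρ c) fun r u => sw (Δ u) fun u₁ u₂ =>
          ε (p * u₂) • ε (u₁ * p') • ε (q * (r * h) * q') • m := by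
        exact (sw_comul_coact hρ c (fun r u₁ u₂ => ε (p * u₂) • ε (u₁ * p') •
          ε (q * (r * h) * q') • m) (by fun_prop) (by fun_prop) (by fun_prop)).symm
    _ = _ := by
        simp only [sw_counit_mul_right hC]

end SmashCounitMul

/-! ### Weak comultiplicativity of the unit -/

section SmashComulOne

variable {k C H M : Type*} [Field k] [Ring C] [Algebra k C] [Coalgebra k C]
  [CommRing H] [Algebra k H] [Coalgebra k H] [AddCommGroup M] [Module k M]
  {ρ : C →ₗ[k] H ⊗[k] C}

local notation "Δ" => Coalgebra.comul (R := k)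

/-- Modulo `E` in the middle factor, the coaction `1⁻¹` on the unit can be absorbed: since `1⁻¹`
lies in `H_s`, it moves across `Δ(1_H)` and becomes `ε_t(1⁻¹)`, which is part of `E`. -/
theorem sw_coact_one_absorb (hH : IsWeakBialg k H) (hρ : IsComoduleBialgebra ρ)
    (Φ : H → C ⊗[k] H → C ⊗[k] H → M) (h1 : ∀ b c, Lin k fun a => Φ a b c)
    (h2 : ∀ a c, Lin k fun b => Φ a b c) (h3 : ∀ a b, Lin k fun c => Φ a b c)
    (hE : ∀ u a b, Φ u (smashUnit ρ * a) b = Φ u a b) :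
    sw (ρ 1) (fun r s => sw (Δ s) fun d₁ d₂ => sw (ρ d₂) fun q p =>
        sw (Δ (1 : H)) fun h₁ h₂ => sw (Δ h₂) fun h₃ h₄ =>
        Φ (r * h₁) (d₁ ⊗ₜ[k] (q * h₃)) (p ⊗ₜ[k] h₄)) =
      sw (Δ (1 : C)) fun d₁ d₂ => sw (ρ d₂) fun q p =>
        sw (Δ (1 : H)) fun h₁ h₂ => sw (Δ h₂) fun h₃ h₄ =>
        Φ h₁ (d₁ ⊗ₜ[k] (q * h₃)) (p ⊗ₜ[k] h₄) := by
  calc sw (ρ 1) (fun r s => sw (Δ s) fun d₁ d₂ => sw (ρ d₂) fun q p =>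
          sw (Δ (1 : H)) fun h₁ h₂ => sw (Δ h₂) fun h₃ h₄ =>
          Φ (r * h₁) (d₁ ⊗ₜ[k] (q * h₃)) (p ⊗ₜ[k] h₄))
      = sw (ρ 1) fun r s => sw (Δ s) fun d₁ d₂ => sw (ρ d₂) fun q p =>
          sw (Δ (1 : H)) fun h₁ h₂ => sw (Δ h₂) fun h₃ h₄ =>
          Φ h₁ (d₁ ⊗ₜ[k] (q * (εt k H r * h₃))) (p ⊗ₜ[k] h₄) := by
        rw [← sw_coact_one hρ _ (by fun_prop) (by fun_prop),
          ← sw_coact_one hρ (fun r s => sw (Δ s) fun d₁ d₂ => sw (ρ d₂) fun q p =>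
          sw (Δ (1 : H)) fun h₁ h₂ => sw (Δ h₂) fun h₃ h₄ =>
          Φ h₁ (d₁ ⊗ₜ[k] (q * (εt k H r * h₃))) (p ⊗ₜ[k] h₄)) (by fun_prop) (by fun_prop)]
        refine sw_congr _ fun r s => sw_congr _ fun d₁ d₂ => sw_congr _ fun q p => ?_
        simp only [mul_comm (εs k H r)]
        rw [sw_comul_one_mul_εs hH r (fun h₁ h₂ => sw (Δ h₂) fun h₃ h₄ =>
          Φ h₁ (d₁ ⊗ₜ[k] (q * h₃)) (p ⊗ₜ[k] h₄)) (by fun_prop) (by fun_prop)]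
        simp only [mul_comm _ (εt k H (εs k H r))]
        simp (disch := fun_prop) only [sw_comul_εt_mul hH]
    _ = sw (Δ (1 : C)) fun d₁ d₂ => sw (ρ d₁) fun r s => sw (ρ d₂) fun r' s' =>
          sw (ρ s') fun q p => sw (Δ (1 : H)) fun h₁ h₂ => sw (Δ h₂) fun h₃ h₄ =>
          Φ h₁ (s ⊗ₜ[k] (εt k H r' * q * (εt k H r * h₃))) (p ⊗ₜ[k] h₄) := by
        rw [sw_comul_coact hρ 1 (fun r d₁ d₂ => sw (ρ d₂) fun q p =>
          sw (Δ (1 : H)) fun h₁ h₂ => sw (Δ h₂) fun h₃ h₄ =>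
          Φ h₁ (d₁ ⊗ₜ[k] (q * (εt k H r * h₃))) (p ⊗ₜ[k] h₄)) (by fun_prop) (by fun_prop)
          (by fun_prop)]
        simp only [εt_mul hH, mul_comm, mul_left_comm]
    _ = sw (Δ (1 : C)) fun d₁ d₂ => sw (ρ d₁) fun r s => sw (ρ d₂) fun q p =>
          sw (Δ (1 : H)) fun h₁ h₂ => sw (Δ h₂) fun h₃ h₄ =>
          Φ h₁ (s ⊗ₜ[k] (εt k H r * (q * h₃))) (p ⊗ₜ[k] h₄) := by
        refine sw_congr _ fun d₁ d₂ => sw_congr _ fun r s => ?_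
        simp only [mul_left_comm (εt k H r)]
        exact sw_coact_εt_coact hH hρ d₂ (fun q p => sw (Δ (1 : H)) fun h₁ h₂ =>
          sw (Δ h₂) fun h₃ h₄ => Φ h₁ (s ⊗ₜ[k] (q * (εt k H r * h₃))) (p ⊗ₜ[k] h₄))
          (by fun_prop) (by fun_prop)
    _ = _ := by
        refine sw_congr _ fun d₁ d₂ => ?_
        simp only [sw_swap (ρ d₁)]
        refine sw_congr _ fun q p => sw_congr _ fun h₁ h₂ => sw_congr _ fun h₃ h₄ => ?_
        rw [← hE, map_smashUnit_mul_tmul hH hρ (F := fun u => Φ h₁ u (p ⊗ₜ[k] h₄)) (by fun_prop)]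

/-- `(I ⊗ Δ')Δ'(1)` after the comodule coalgebra axiom has been applied to its second leg. -/
theorem sw_smashComul_one_comul (hρ : IsComoduleBialgebra ρ)
    (F : C ⊗[k] H → C ⊗[k] H → C ⊗[k] H → M) (h1 : ∀ b c, Lin k fun a => F a b c)
    (h2 : ∀ a c, Lin k fun b => F a b c) (h3 : ∀ a b, Lin k fun c => F a b c) :
    sw (smashComul ρ (1 ⊗ₜ[k] 1)) (fun a b => sw (smashComul ρ b) fun c d => F a c d) =
      sw (Δ (1 : C)) fun c₁ c₂ => sw (Δ c₂) fun c₃ c₄ => sw (ρ c₃) fun q p =>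
        sw (ρ c₄) fun q' p' => sw (ρ p') fun r s => sw (Δ (1 : H)) fun h₁ h₂ =>
        sw (Δ h₂) fun h₃ h₄ =>
        F (c₁ ⊗ₜ[k] (q * q' * h₁)) (p ⊗ₜ[k] (r * h₃)) (s ⊗ₜ[k] h₄) := by
  simp (disch := fun_prop) only [sw_smashComul]
  refine sw_congr _ fun c₁ c₂ => ?_
  rw [← sw_comul_coact hρ c₂ (fun q p p' => sw (ρ p') fun r s => sw (Δ (1 : H)) fun h₁ h₂ =>
    sw (Δ h₂) fun h₃ h₄ => F (c₁ ⊗ₜ[k] (q * h₁)) (p ⊗ₜ[k] (r * h₃)) (s ⊗ₜ[k] h₄))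
    (by fun_prop) (by fun_prop) (by fun_prop)]
  refine sw_congr _ fun q p => ?_
  simp only [sw_swap (Δ (1 : H))]

/-- `(1 ⊗ Δ'(1))(Δ'(1) ⊗ 1) = (I ⊗ Δ')Δ'(1)` modulo `E` -/
theorem sw_smashComul_one_left (hC : IsWeakBialg k C) (hH : IsWeakBialg k H)
    (hρ : IsComoduleBialgebra ρ)
    (F : C ⊗[k] H → C ⊗[k] H → C ⊗[k] H → M) (h1 : ∀ b c, Lin k fun a => F a b c)
    (h2 : ∀ a c, Lin k fun b => F a b c) (h3 : ∀ a b, Lin k fun c => F a b c)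
    (hE : ∀ a b c, F a (smashUnit ρ * b) c = F a b c) :
    sw (smashComul ρ (1 ⊗ₜ[k] 1))
        (fun a b => sw (smashComul ρ (1 ⊗ₜ[k] 1)) fun c d => F a (c * b) d) =
      sw (smashComul ρ (1 ⊗ₜ[k] 1)) fun a b => sw (smashComul ρ b) fun c d => F a c d := by
  rw [sw_smashComul_one_comul hρ F h1 h2 h3]
  simp (disch := fun_prop) only [sw_smashComul, Algebra.TensorProduct.tmul_mul_tmul]
  symm
  calc sw (Δ (1 : C)) (fun c₁ c₂ => sw (Δ c₂) fun c₃ c₄ => sw (ρ c₃) fun q p =>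
        sw (ρ c₄) fun q' p' => sw (ρ p') fun r s => sw (Δ (1 : H)) fun h₁ h₂ =>
        sw (Δ h₂) fun h₃ h₄ =>
        F (c₁ ⊗ₜ[k] (q * q' * h₁)) (p ⊗ₜ[k] (r * h₃)) (s ⊗ₜ[k] h₄))
      = sw (Δ (1 : C)) fun c₁ c₂ => sw (ρ c₂) fun q p => sw (Δ (1 : C)) fun d₁ d₂ =>
        sw (ρ d₁) fun r s => sw (ρ d₂) fun r' s' => sw (ρ s') fun q' p' =>
        sw (Δ (1 : H)) fun h₁ h₂ => sw (Δ h₂) fun h₃ h₄ =>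
        F (c₁ ⊗ₜ[k] (q * (r * r' * h₁))) ((s * p) ⊗ₜ[k] (q' * h₃)) (p' ⊗ₜ[k] h₄) := by
        rw [← sw_comul_one_left hC (fun c₁ c₃ c₄ => sw (ρ c₃) fun q p =>
          sw (ρ c₄) fun q' p' => sw (ρ p') fun r s => sw (Δ (1 : H)) fun h₁ h₂ =>
          sw (Δ h₂) fun h₃ h₄ => F (c₁ ⊗ₜ[k] (q * q' * h₁)) (p ⊗ₜ[k] (r * h₃)) (s ⊗ₜ[k] h₄))
          (by fun_prop) (by fun_prop) (by fun_prop)]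
        simp (disch := fun_prop) only [sw_coact_mul hρ]
        refine sw_congr _ fun c₁ c₂ => ?_
        simp only [sw_swap _ (ρ c₂)]
        simp only [mul_comm, mul_left_comm]
    _ = sw (Δ (1 : C)) fun c₁ c₂ => sw (ρ c₂) fun q p => sw (Δ (1 : C)) fun d₁ d₂ =>
        sw (ρ d₂) fun q' p' => sw (Δ (1 : H)) fun h₁ h₂ => sw (Δ h₂) fun h₃ h₄ =>
        F (c₁ ⊗ₜ[k] (q * h₁)) ((d₁ * p) ⊗ₜ[k] (q' * h₃)) (p' ⊗ₜ[k] h₄) := by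
        refine sw_congr _ fun c₁ c₂ => sw_congr _ fun q p => ?_
        have h := sw_coact_one_absorb hH hρ
          (fun u a b => F (c₁ ⊗ₜ[k] (q * u)) (a * p ⊗ₜ[k] 1) b) (by fun_prop) (by fun_prop)
          (by fun_prop) (fun u a b => by rw [mul_assoc, hE])
        simp only [Algebra.TensorProduct.tmul_mul_tmul, mul_one] at h
        rw [← h, sw_comul_coact hρ 1 (fun r d₁ d₂ => sw (ρ d₂) fun q' p' =>
          sw (Δ (1 : H)) fun h₁ h₂ => sw (Δ h₂) fun h₃ h₄ =>
          F (c₁ ⊗ₜ[k] (q * (r * h₁))) ((d₁ * p) ⊗ₜ[k] (q' * h₃)) (p' ⊗ₜ[k] h₄)) (by fun_prop)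
          (by fun_prop) (by fun_prop)]
    _ = _ := by
        refine sw_congr _ fun c₁ c₂ => sw_congr _ fun q p => ?_
        simp only [sw_swap (Δ (1 : H)) (Δ (1 : C)), sw_swap (Δ (1 : H)) (ρ _)]
        refine sw_congr _ fun d₁ d₂ => sw_congr _ fun q' p' => ?_
        rw [← sw_comul_one_left hH (fun h₁ h₃ h₄ =>
          F (c₁ ⊗ₜ[k] (q * h₁)) ((d₁ * p) ⊗ₜ[k] (q' * h₃)) (p' ⊗ₜ[k] h₄)) (by fun_prop)
          (by fun_prop) (by fun_prop)]
        simp only [mul_assoc]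

/-- `(Δ'(1) ⊗ 1)(1 ⊗ Δ'(1)) = (I ⊗ Δ')Δ'(1)` modulo `E` -/
theorem sw_smashComul_one_right (hC : IsWeakBialg k C) (hH : IsWeakBialg k H)
    (hρ : IsComoduleBialgebra ρ)
    (F : C ⊗[k] H → C ⊗[k] H → C ⊗[k] H → M) (h1 : ∀ b c, Lin k fun a => F a b c)
    (h2 : ∀ a c, Lin k fun b => F a b c) (h3 : ∀ a b, Lin k fun c => F a b c)
    (hE : ∀ a b c, F a (smashUnit ρ * b) c = F a b c) :
    sw (smashComul ρ (1 ⊗ₜ[k] 1))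
        (fun a b => sw (smashComul ρ (1 ⊗ₜ[k] 1)) fun c d => F a (b * c) d) =
      sw (smashComul ρ (1 ⊗ₜ[k] 1)) fun a b => sw (smashComul ρ b) fun c d => F a c d := by
  rw [sw_smashComul_one_comul hρ F h1 h2 h3]
  simp (disch := fun_prop) only [sw_smashComul, Algebra.TensorProduct.tmul_mul_tmul]
  symm
  calc sw (Δ (1 : C)) (fun c₁ c₂ => sw (Δ c₂) fun c₃ c₄ => sw (ρ c₃) fun q p =>
        sw (ρ c₄) fun q' p' => sw (ρ p') fun r s => sw (Δ (1 : H)) fun h₁ h₂ =>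
        sw (Δ h₂) fun h₃ h₄ =>
        F (c₁ ⊗ₜ[k] (q * q' * h₁)) (p ⊗ₜ[k] (r * h₃)) (s ⊗ₜ[k] h₄))
      = sw (Δ (1 : C)) fun c₁ c₂ => sw (ρ c₂) fun q p => sw (Δ (1 : C)) fun d₁ d₂ =>
        sw (ρ d₁) fun r s => sw (ρ d₂) fun r' s' => sw (ρ s') fun q' p' =>
        sw (Δ (1 : H)) fun h₁ h₂ => sw (Δ h₂) fun h₃ h₄ =>
        F (c₁ ⊗ₜ[k] (q * (r * r' * h₁))) ((p * s) ⊗ₜ[k] (q' * h₃)) (p' ⊗ₜ[k] h₄) := by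
        rw [← sw_comul_one_right hC (fun c₁ c₃ c₄ => sw (ρ c₃) fun q p =>
          sw (ρ c₄) fun q' p' => sw (ρ p') fun r s => sw (Δ (1 : H)) fun h₁ h₂ =>
          sw (Δ h₂) fun h₃ h₄ => F (c₁ ⊗ₜ[k] (q * q' * h₁)) (p ⊗ₜ[k] (r * h₃)) (s ⊗ₜ[k] h₄))
          (by fun_prop) (by fun_prop) (by fun_prop)]
        simp (disch := fun_prop) only [sw_coact_mul hρ]
        refine sw_congr _ fun c₁ c₂ => ?_
        simp only [sw_swap _ (ρ c₂)]
        simp only [mul_assoc]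
    _ = sw (Δ (1 : C)) fun c₁ c₂ => sw (ρ c₂) fun q p => sw (Δ (1 : C)) fun d₁ d₂ =>
        sw (ρ d₂) fun q' p' => sw (Δ (1 : H)) fun h₁ h₂ => sw (Δ h₂) fun h₃ h₄ =>
        F (c₁ ⊗ₜ[k] (q * h₁)) ((p * d₁) ⊗ₜ[k] (q' * h₃)) (p' ⊗ₜ[k] h₄) := by
        refine sw_congr _ fun c₁ c₂ => sw_congr _ fun q p => ?_
        have h := sw_coact_one_absorb hH hρ
          (fun u a b => F (c₁ ⊗ₜ[k] (q * u)) (p ⊗ₜ[k] 1 * a) b) (by fun_prop) (by fun_prop)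
          (by fun_prop) (fun u a b => by
            rw [← mul_assoc, ← smashUnit_mul_comm hH hρ, mul_assoc, hE])
        simp only [Algebra.TensorProduct.tmul_mul_tmul, one_mul] at h
        rw [← h, sw_comul_coact hρ 1 (fun r d₁ d₂ => sw (ρ d₂) fun q' p' =>
          sw (Δ (1 : H)) fun h₁ h₂ => sw (Δ h₂) fun h₃ h₄ =>
          F (c₁ ⊗ₜ[k] (q * (r * h₁))) ((p * d₁) ⊗ₜ[k] (q' * h₃)) (p' ⊗ₜ[k] h₄)) (by fun_prop)
          (by fun_prop) (by fun_prop)]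
    _ = _ := by
        refine sw_congr _ fun c₁ c₂ => sw_congr _ fun q p => ?_
        simp only [sw_swap (Δ (1 : H)) (Δ (1 : C)), sw_swap (Δ (1 : H)) (ρ _)]
        refine sw_congr _ fun d₁ d₂ => sw_congr _ fun q' p' => ?_
        rw [← sw_comul_one_left hH (fun h₁ h₃ h₄ =>
          F (c₁ ⊗ₜ[k] (q * h₁)) ((p * d₁) ⊗ₜ[k] (q' * h₃)) (p' ⊗ₜ[k] h₄)) (by fun_prop)
          (by fun_prop) (by fun_prop)]
        refine sw_congr _ fun h₁ h₂ => sw_congr _ fun h₃ h₄ => ?_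
        rw [mul_left_comm, mul_comm h₃, mul_left_comm, mul_assoc]

end SmashComulOne

/-! ### The antipode on `C ⊗ H` -/

section SmashAntipode

variable {k C H M : Type*} [Field k] [Ring C] [Algebra k C] [Coalgebra k C]
  [CommRing H] [Algebra k H] [Coalgebra k H] [AddCommGroup M] [Module k M]
  {ρ : C →ₗ[k] H ⊗[k] C} {SC : C →ₗ[k] C} {SH : H →ₗ[k] H}

local notation "Δ" => Coalgebra.comul (R := k)
local notation "ε" => Coalgebra.counit (R := k)

variable (ρ) in
/-- The linear map `c ⊗ h ↦ ε_t(c⁰) ⊗ ε_t(c⁻¹h)`, which gives the target map of the weak smash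
coproduct. -/
def smashTarget : C ⊗[k] H →ₗ[k] C ⊗[k] H := TensorProduct.map (εt k C) (εt k H) ∘ₗ twist ρ

variable (ρ SH) in
/-- The linear map `c ⊗ h ↦ ε_s(c⁰) ⊗ S_H(c⁻¹) ε_s(h)`, which gives the source map of the weak
smash coproduct. -/
def smashSource : C ⊗[k] H →ₗ[k] C ⊗[k] H :=
  TensorProduct.map (εs k C) (LinearMap.mul' k H) ∘ₗ (TensorProduct.assoc k C H H).toLinearMap ∘ₗ
    TensorProduct.map ((TensorProduct.comm k H C).toLinearMap ∘ₗ SH.rTensor C ∘ₗ ρ) (εs k H)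

theorem smashTarget_tmul (c : C) (h : H) :
    smashTarget ρ (c ⊗ₜ[k] h) = sw (ρ c) fun q p => εt k C p ⊗ₜ[k] εt k H (q * h) := by
  rw [smashTarget, LinearMap.comp_apply, twist_tmul, map_sw]
  rfl

theorem smashSource_tmul (c : C) (h : H) :
    smashSource ρ SH (c ⊗ₜ[k] h) = sw (ρ c) fun q p => εs k C p ⊗ₜ[k] (SH q * εs k H h) := by
  rw [← sw_tmul_eq (smashSource ρ SH (c ⊗ₜ[k] h))]
  simp (disch := fun_prop) only [smashSource, LinearMap.comp_apply, LinearEquiv.coe_coe,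
    TensorProduct.map_tmul, sw_map, sw_assoc, sw_tmul, sw_comm, sw_rTensor, mul'_eq_sw]

theorem map_smashCounit_smul (c : C) (h : H) (m : M) :
    smashCounit ρ (c ⊗ₜ[k] h) • m = sw (ρ c) fun q p => ε p • ε (q * h) • m := by
  rw [smashCounit_tmul, Lin.map_sw (G := fun r : k => r • m) (by fun_prop)]
  simp only [smul_assoc]

/-- `x₁ S'(x₂)` modulo `E` -/
theorem sw_mul_smashAntipode (hC : IsAntipode SC) (hH : IsAntipode SH)
    (hρ : IsComoduleBialgebra ρ) (x : C ⊗[k] H) (F : C ⊗[k] H → M) (hF : Lin k F)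
    (hE : ∀ x, F (smashUnit ρ * x) = F x) :
    sw (smashComul ρ x) (fun a b => F (a * smashAntipode ρ SC SH b)) = F (smashTarget ρ x) := by
  have hH' : IsWeakBialg k H := hH.toIsWeakBialgebra
  refine Lin.ext_tmul (k := k)
    (f := fun x => sw (smashComul ρ x) fun a b => F (a * smashAntipode ρ SC SH b))
    (g := fun x => F (smashTarget ρ x)) (by fun_prop) (by fun_prop) (fun c h => ?_) x
  have h' (p : C) (a : C ⊗[k] H) (h₂ : H) : F (a * smashAntipode ρ SC SH (p ⊗ₜ[k] h₂)) =
      sw (ρ p) fun r s => F (a * SC s ⊗ₜ[k] SH (r * h₂)) := by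
    rw [smashAntipode_tmul, Lin.map_sw (k := k) (G := fun u => F (a * u)) (by fun_prop)]
  simp (disch := fun_prop) only [sw_smashComul, h', Algebra.TensorProduct.tmul_mul_tmul]
  calc sw (Δ c) (fun c₁ c₂ => sw (ρ c₂) fun q p => sw (Δ h) fun h₁ h₂ => sw (ρ p) fun r s =>
          F ((c₁ * SC s) ⊗ₜ[k] (q * h₁ * SH (r * h₂))))
      = sw (Δ c) fun c₁ c₂ => sw (ρ c₂) fun q p => sw (Δ q) fun r s => sw (Δ h) fun h₁ h₂ =>
          F ((c₁ * SC p) ⊗ₜ[k] (r * h₁ * SH (s * h₂))) := by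
        refine sw_congr _ fun c₁ c₂ => ?_
        simp only [sw_swap (Δ h)]
        exact sw_coact_coact hρ c₂ (fun q r s => sw (Δ h) fun h₁ h₂ =>
          F ((c₁ * SC s) ⊗ₜ[k] (q * h₁ * SH (r * h₂)))) (by fun_prop) (by fun_prop) (by fun_prop)
    _ = sw (Δ c) fun c₁ c₂ => sw (ρ c₁) fun q' p' => sw (ρ c₂) fun q p =>
          F ((p' * SC p) ⊗ₜ[k] (εt k H (q' * q * h))) := by
        refine sw_congr _ fun c₁ c₂ => ?_
        rw [sw_swap]
        refine sw_congr _ fun q p => ?_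
        rw [← sw_comul_mul hH' q h (fun a b => F ((c₁ * SC p) ⊗ₜ[k] (a * SH b))) (by fun_prop)
          (by fun_prop), sw_mul_antipode hH (q * h) (fun u => F ((c₁ * SC p) ⊗ₜ[k] u))
          (by fun_prop)]
        have := map_smashUnit_mul_tmul hH' hρ (F := fun u => F (u * (SC p ⊗ₜ[k] 1))) (by fun_prop)
          c₁ (εt k H (q * h))
        simp only [mul_assoc, hE, Algebra.TensorProduct.tmul_mul_tmul, mul_one] at this
        rw [this]
        simp only [εt_mul hH', mul_assoc]
    _ = sw (ρ c) fun q p => sw (Δ p) fun p₁ p₂ => F ((p₁ * SC p₂) ⊗ₜ[k] (εt k H (q * h))) :=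
        (sw_comul_coact hρ c (fun q p₁ p₂ => F ((p₁ * SC p₂) ⊗ₜ[k] (εt k H (q * h))))
          (by fun_prop) (by fun_prop) (by fun_prop)).symm
    _ = _ := by
        rw [smashTarget_tmul, hF.map_sw]
        refine sw_congr _ fun q p => ?_
        exact sw_mul_antipode hC p (fun u => F (u ⊗ₜ[k] (εt k H (q * h)))) (by fun_prop)

/-- `ε'(1₁ x) 1₂` modulo `E` -/
theorem sw_smashTarget (hC : IsWeakBialg k C) (hH : IsWeakBialg k H)
    (hρ : IsComoduleBialgebra ρ) (x : C ⊗[k] H) (F : C ⊗[k] H → M) (hF : Lin k F)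
    (hE : ∀ x, F (smashUnit ρ * x) = F x) :
    sw (smashComul ρ (1 ⊗ₜ[k] 1)) (fun a b => smashCounit ρ (a * x) • F b) =
      F (smashTarget ρ x) := by
  refine Lin.ext_tmul (k := k)
    (f := fun x => sw (smashComul ρ (1 ⊗ₜ[k] 1)) fun a b => smashCounit ρ (a * x) • F b)
    (g := fun x => F (smashTarget ρ x)) (by fun_prop) (by fun_prop) (fun c h => ?_) x
  simp (disch := fun_prop) only [sw_smashComul, map_smashCounit_smul, sw_coact_mul hρ,
    Algebra.TensorProduct.tmul_mul_tmul]
  calc sw (Δ (1 : C)) (fun c₁ c₂ => sw (ρ c₂) fun q p => sw (Δ (1 : H)) fun h₁ h₂ =>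
          sw (ρ c₁) fun r s => sw (ρ c) fun r' s' =>
          ε (s * s') • ε (r * r' * (q * h₁ * h)) • F (p ⊗ₜ[k] h₂))
      = sw (Δ (1 : C)) fun c₁ c₂ => sw (ρ c₁) fun r s => sw (ρ c₂) fun q p => sw (ρ c) fun r' s' =>
          ε (s * s') • sw (Δ (1 : H)) fun h₁ h₂ => ε (h₁ * (r * q * r' * h)) • F (p ⊗ₜ[k] h₂) := by
        refine sw_congr _ fun c₁ c₂ => ?_
        simp only [sw_swap _ (ρ c₁), smul_sw]
        refine sw_congr _ fun r s => sw_congr _ fun q p => ?_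
        rw [sw_swap]
        refine sw_congr _ fun r' s' => sw_congr _ fun h₁ h₂ => ?_
        rw [show r * r' * (q * h₁ * h) = h₁ * (r * q * r' * h) by ring]
    _ = sw (ρ 1) fun q p => sw (Δ p) fun p₁ p₂ => sw (ρ c) fun r' s' =>
          ε (p₁ * s') • F (p₂ ⊗ₜ[k] (εt k H q * εt k H (r' * h))) := by
        rw [sw_comul_coact hρ 1 (fun q p₁ p₂ => sw (ρ c) fun r' s' =>
          ε (p₁ * s') • F (p₂ ⊗ₜ[k] (εt k H q * εt k H (r' * h)))) (by fun_prop) (by fun_prop)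
          (by fun_prop)]
        refine sw_congr _ fun c₁ c₂ => sw_congr _ fun r s => sw_congr _ fun q p =>
          sw_congr _ fun r' s' => ?_
        rw [sw_counit_mul_smul hH 1 _ (fun u => F (p ⊗ₜ[k] u)) (by fun_prop)]
        simp only [one_mul, εt_mul hH, mul_assoc]
    _ = sw (ρ c) fun r' s' => sw (ρ 1) fun q p =>
          F ((p * εt k C s') ⊗ₜ[k] (εt k H q * εt k H (r' * h))) := by
        rw [sw_swap (ρ c)]
        refine sw_congr _ fun q p => ?_
        rw [sw_swap]
        refine sw_congr _ fun r' s' => ?_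
        exact sw_counit_mul_smul hC p s' (fun u => F (u ⊗ₜ[k] (εt k H q * εt k H (r' * h))))
          (by fun_prop)
    _ = _ := by
        rw [smashTarget_tmul, hF.map_sw]
        refine sw_congr _ fun r' s' => ?_
        rw [← hE, map_smashUnit_mul_tmul hH hρ hF, sw_coact_εt_left hH hρ _
          (fun q p => F (p ⊗ₜ[k] (q * εt k H (r' * h)))) (by fun_prop) (by fun_prop)]

/-- `S'(x₁) x₂` -/
theorem sw_smashAntipode_mul (hC : IsAntipode SC) (hH : IsAntipode SH)
    (hρ : IsComoduleBialgebra ρ) (x : C ⊗[k] H) (F : C ⊗[k] H → M) (hF : Lin k F) :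
    sw (smashComul ρ x) (fun a b => F (smashAntipode ρ SC SH a * b)) = F (smashSource ρ SH x) := by
  refine Lin.ext_tmul (k := k)
    (f := fun x => sw (smashComul ρ x) fun a b => F (smashAntipode ρ SC SH a * b))
    (g := fun x => F (smashSource ρ SH x)) (by fun_prop) (by fun_prop) (fun c h => ?_) x
  have h' (p : C) (a : C ⊗[k] H) (h₂ : H) : F (smashAntipode ρ SC SH (p ⊗ₜ[k] h₂) * a) =
      sw (ρ p) fun r s => F (SC s ⊗ₜ[k] SH (r * h₂) * a) := by
    rw [smashAntipode_tmul, Lin.map_sw (k := k) (G := fun u => F (u * a)) (by fun_prop)]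
  simp (disch := fun_prop) only [sw_smashComul, h', Algebra.TensorProduct.tmul_mul_tmul]
  calc sw (Δ c) (fun c₁ c₂ => sw (ρ c₂) fun q p => sw (Δ h) fun h₁ h₂ => sw (ρ c₁) fun r s =>
          F ((SC s * p) ⊗ₜ[k] (SH (r * (q * h₁)) * h₂)))
      = sw (ρ c) fun q p => sw (Δ p) fun p₁ p₂ => sw (Δ h) fun h₁ h₂ =>
          F ((SC p₁ * p₂) ⊗ₜ[k] (SH q * (SH h₁ * h₂))) := by
        rw [sw_comul_coact hρ c (fun q p₁ p₂ => sw (Δ h) fun h₁ h₂ =>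
          F ((SC p₁ * p₂) ⊗ₜ[k] (SH q * (SH h₁ * h₂)))) (by fun_prop) (by fun_prop)
          (by fun_prop)]
        refine sw_congr _ fun c₁ c₂ => ?_
        simp only [sw_swap _ (ρ c₁), antipode_mul hH, mul_assoc]
    _ = _ := by
        rw [smashSource_tmul, hF.map_sw]
        refine sw_congr _ fun q p => ?_
        rw [sw_antipode_mul hC p (fun u => sw (Δ h) fun h₁ h₂ =>
          F (u ⊗ₜ[k] (SH q * (SH h₁ * h₂)))) (by fun_prop)]
        exact sw_antipode_mul hH h (fun u => F (εs k C p ⊗ₜ[k] (SH q * u))) (by fun_prop)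

/-- `1₁ ε'(x 1₂)` modulo `E` -/
theorem sw_smashSource (hC : IsWeakBialg k C) (hH : IsAntipode SH)
    (hρ : IsComoduleBialgebra ρ) (x : C ⊗[k] H) (F : C ⊗[k] H → M) (hF : Lin k F)
    (hE : ∀ x, F (smashUnit ρ * x) = F x) :
    sw (smashComul ρ (1 ⊗ₜ[k] 1)) (fun a b => smashCounit ρ (x * b) • F a) =
      F (smashSource ρ SH x) := by
  have hH' : IsWeakBialg k H := hH.toIsWeakBialgebra
  refine Lin.ext_tmul (k := k)
    (f := fun x => sw (smashComul ρ (1 ⊗ₜ[k] 1)) fun a b => smashCounit ρ (x * b) • F a)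
    (g := fun x => F (smashSource ρ SH x)) (by fun_prop) (by fun_prop) (fun c h => ?_) x
  simp (disch := fun_prop) only [sw_smashComul, map_smashCounit_smul, sw_coact_mul hρ,
    Algebra.TensorProduct.tmul_mul_tmul]
  calc sw (Δ (1 : C)) (fun c₁ c₂ => sw (ρ c₂) fun q p => sw (Δ (1 : H)) fun h₁ h₂ =>
          sw (ρ c) fun r s => sw (ρ p) fun q' p' =>
          ε (s * p') • ε (r * q' * (h * h₂)) • F (c₁ ⊗ₜ[k] (q * h₁)))
      = sw (ρ c) fun r s => sw (Δ (1 : C)) fun c₁ c₂ => sw (ρ c₂) fun q p => sw (ρ p) fun q' p' =>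
          sw (Δ (1 : H)) fun h₁ h₂ =>
          ε (s * p') • ε (r * h * (q' * h₂)) • F (c₁ ⊗ₜ[k] (q * h₁)) := by
        simp only [sw_swap _ (ρ c)]
        refine sw_congr _ fun r s => sw_congr _ fun c₁ c₂ => sw_congr _ fun q p => ?_
        rw [sw_swap]
        simp only [mul_mul_mul_comm]
    _ = sw (ρ c) fun r s => sw (Δ (1 : C)) fun c₁ c₂ => sw (ρ c₂) fun q p => sw (Δ q) fun q₁ q₂ =>
          sw (Δ (1 : H)) fun h₁ h₂ =>
          ε (s * p) • ε (r * h * (q₂ * h₂)) • F (c₁ ⊗ₜ[k] (q₁ * h₁)) := by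
        refine sw_congr _ fun r s => sw_congr _ fun c₁ c₂ => ?_
        exact sw_coact_coact hρ c₂ (fun q q' p' => sw (Δ (1 : H)) fun h₁ h₂ =>
          ε (s * p') • ε (r * h * (q' * h₂)) • F (c₁ ⊗ₜ[k] (q * h₁))) (by fun_prop) (by fun_prop)
          (by fun_prop)
    _ = sw (ρ c) fun r s => sw (Δ (1 : C)) fun c₁ c₂ => sw (ρ c₂) fun q p =>
          ε (s * p) • F (c₁ ⊗ₜ[k] (εs k H r * (εs k H h * q))) := by
        refine sw_congr _ fun r s => sw_congr _ fun c₁ c₂ => sw_congr _ fun q p => ?_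
        rw [← sw_comul_mul hH' q 1 (fun a b => ε (s * p) • ε (r * h * b) • F (c₁ ⊗ₜ[k] a))
          (by fun_prop) (by fun_prop), mul_one]
        simp only [smul_comm (ε (s * p))]
        rw [sw_counit_mul_smul' hH' q (r * h) (fun u => ε (s * p) • F (c₁ ⊗ₜ[k] u)) (by fun_prop),
          εs_mul hH', mul_assoc]
    _ = sw (ρ c) fun r s => sw (ρ s) fun r' s' => sw (Δ (1 : C)) fun c₁ c₂ => sw (ρ c₂) fun q p =>
          ε (s' * p) • F (c₁ ⊗ₜ[k] (SH r * r' * (εs k H h * q))) := by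
        rw [sw_coact_coact hρ c (fun r r' s' => sw (Δ (1 : C)) fun c₁ c₂ => sw (ρ c₂) fun q p =>
          ε (s' * p) • F (c₁ ⊗ₜ[k] (SH r * r' * (εs k H h * q)))) (by fun_prop) (by fun_prop)
          (by fun_prop)]
        refine sw_congr _ fun r s => ?_
        exact (sw_antipode_mul hH r (fun u => sw (Δ (1 : C)) fun c₁ c₂ => sw (ρ c₂) fun q p =>
          ε (s * p) • F (c₁ ⊗ₜ[k] (u * (εs k H h * q)))) (by fun_prop)).symm
    _ = sw (ρ c) fun r s => sw (Δ (1 : C)) fun c₁ c₂ => sw (ρ (s * c₂)) fun q p =>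
          ε p • F (c₁ ⊗ₜ[k] (q * (SH r * εs k H h))) := by
        refine sw_congr _ fun r s => ?_
        rw [sw_swap]
        simp (disch := fun_prop) only [sw_coact_mul hρ]
        refine sw_congr _ fun c₁ c₂ => sw_congr _ fun r' s' => sw_congr _ fun q p => ?_
        rw [show SH r * r' * (εs k H h * q) = r' * q * (SH r * εs k H h) by ring]
    -- The axiom on `c⁻¹ ε_C(c⁰)` turns the coaction on `s c₂` into its target part, which belongs
    -- to `E` and so only sees the factor `c₂`.
    _ = sw (ρ c) fun r s => sw (Δ (1 : C)) fun c₁ c₂ => sw (ρ c₂) fun q p =>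
          ε (s * p) • F (c₁ ⊗ₜ[k] (εt k H q * (SH r * εs k H h))) := by
        refine sw_congr _ fun r s => sw_congr _ fun c₁ c₂ => ?_
        rw [← sw_coact_counit hρ (s * c₂) (fun q => F (c₁ ⊗ₜ[k] (q * (SH r * εs k H h))))
          (by fun_prop), sw_coact_mul_εt hH' hρ s c₂
          (fun q p => ε p • F (c₁ ⊗ₜ[k] (q * (SH r * εs k H h)))) (by fun_prop) (by fun_prop)]
    _ = sw (ρ c) fun r s => sw (ρ 1) fun q p => sw (Δ p) fun p₁ p₂ =>
          ε (s * p₂) • F (p₁ ⊗ₜ[k] (εt k H q * (SH r * εs k H h))) := by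
        refine sw_congr _ fun r s => ?_
        rw [sw_comul_coact hρ 1 (fun q p₁ p₂ =>
          ε (s * p₂) • F (p₁ ⊗ₜ[k] (εt k H q * (SH r * εs k H h)))) (by fun_prop) (by fun_prop)
          (by fun_prop)]
        refine sw_congr _ fun c₁ c₂ => ?_
        rw [sw_swap]
        refine sw_congr _ fun q p => ?_
        rw [← hE, map_smashUnit_mul_tmul hH' hρ hF, smul_sw]
        simp only [εt_mul hH', mul_assoc]
    _ = sw (ρ c) fun r s => sw (ρ 1) fun q p =>
          F ((εs k C s * p) ⊗ₜ[k] (εt k H q * (SH r * εs k H h))) := by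
        refine sw_congr _ fun r s => sw_congr _ fun q p => ?_
        exact sw_counit_mul_smul' hC p s
          (fun u => F (u ⊗ₜ[k] (εt k H q * (SH r * εs k H h)))) (by fun_prop)
    _ = _ := by
        rw [smashSource_tmul, hF.map_sw]
        refine sw_congr _ fun r s => ?_
        rw [← hE, map_smashUnit_mul_tmul hH' hρ hF, sw_coact_εt_right hH' hρ _
          (fun q p => F (p ⊗ₜ[k] (q * (SH r * εs k H h)))) (by fun_prop) (by fun_prop)]

/-- `S'(x₁) ε_t(x₂) = S'(x)`, with the target map in the form `smashTarget`. -/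
theorem sw_smashAntipode_mul_smashTarget (hC : IsAntipode SC) (hH : IsAntipode SH)
    (hρ : IsComoduleBialgebra ρ) (x : C ⊗[k] H) (F : C ⊗[k] H → M) (hF : Lin k F) :
    sw (smashComul ρ x) (fun a b => F (smashAntipode ρ SC SH a * smashTarget ρ b)) =
      F (smashAntipode ρ SC SH x) := by
  have hH' : IsWeakBialg k H := hH.toIsWeakBialgebra
  refine Lin.ext_tmul (k := k)
    (f := fun x => sw (smashComul ρ x) fun a b =>
      F (smashAntipode ρ SC SH a * smashTarget ρ b))
    (g := fun x => F (smashAntipode ρ SC SH x)) (by fun_prop) (by fun_prop) (fun c h => ?_) x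
  have h' (p p' : C) (h₁ h₂ : H) :
      F (smashAntipode ρ SC SH (p ⊗ₜ[k] h₁) * smashTarget ρ (p' ⊗ₜ[k] h₂)) =
        sw (ρ p) fun r s => sw (ρ p') fun r' s' =>
          F ((SC s * εt k C s') ⊗ₜ[k] (SH (r * h₁) * εt k H (r' * h₂))) := by
    rw [smashAntipode_tmul, smashTarget_tmul, Lin.map_sw (k := k) (G := fun u => F (u *
      sw (ρ p') fun r' s' => εt k C s' ⊗ₜ[k] εt k H (r' * h₂))) (by fun_prop)]
    refine sw_congr _ fun r s => ?_
    rw [Lin.map_sw (k := k) (G := fun u => F (SC s ⊗ₜ[k] SH (r * h₁) * u)) (by fun_prop)]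
    simp only [Algebra.TensorProduct.tmul_mul_tmul]
  simp (disch := fun_prop) only [sw_smashComul, h']
  calc sw (Δ c) (fun c₁ c₂ => sw (ρ c₂) fun q p => sw (Δ h) fun h₁ h₂ => sw (ρ c₁) fun r s =>
          sw (ρ p) fun r' s' =>
          F ((SC s * εt k C s') ⊗ₜ[k] (SH (r * (q * h₁)) * εt k H (r' * h₂))))
      = sw (Δ c) fun c₁ c₂ => sw (ρ c₁) fun r s => sw (ρ c₂) fun q p => sw (Δ q) fun q₁ q₂ =>
          sw (Δ h) fun h₁ h₂ =>
          F ((SC s * εt k C p) ⊗ₜ[k] (SH r * (SH (q₁ * h₁) * εt k H (q₂ * h₂)))) := by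
        refine sw_congr _ fun c₁ c₂ => ?_
        simp only [sw_swap _ (ρ c₁), sw_swap (Δ h)]
        refine sw_congr _ fun r s => ?_
        simp only [← mul_assoc, ← antipode_mul hH]
        exact sw_coact_coact hρ c₂ (fun q r' s' => sw (Δ h) fun h₁ h₂ =>
          F ((SC s * εt k C s') ⊗ₜ[k] (SH (r * q * h₁) * εt k H (r' * h₂)))) (by fun_prop)
          (by fun_prop) (by fun_prop)
    _ = sw (Δ c) fun c₁ c₂ => sw (ρ c₁) fun r s => sw (ρ c₂) fun q p =>
          F ((SC s * εt k C p) ⊗ₜ[k] SH (r * q * h)) := by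
        refine sw_congr _ fun c₁ c₂ => sw_congr _ fun r s => sw_congr _ fun q p => ?_
        rw [← sw_comul_mul hH' q h (fun a b =>
          F ((SC s * εt k C p) ⊗ₜ[k] (SH r * (SH a * εt k H b)))) (by fun_prop) (by fun_prop),
          sw_antipode_mul_εt hH (q * h) (fun u => F ((SC s * εt k C p) ⊗ₜ[k] (SH r * u)))
          (by fun_prop), ← antipode_mul hH, mul_assoc]
    _ = sw (ρ c) fun q p => sw (Δ p) fun p₁ p₂ => F ((SC p₁ * εt k C p₂) ⊗ₜ[k] SH (q * h)) :=
        (sw_comul_coact hρ c (fun q p₁ p₂ => F ((SC p₁ * εt k C p₂) ⊗ₜ[k] SH (q * h)))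
          (by fun_prop) (by fun_prop) (by fun_prop)).symm
    _ = _ := by
        rw [smashAntipode_tmul, hF.map_sw]
        refine sw_congr _ fun q p => ?_
        exact sw_antipode_mul_εt hC p (fun u => F (u ⊗ₜ[k] SH (q * h))) (by fun_prop)

end SmashAntipode

/-! ### Passage to the weak smash coproduct -/

section Quotient

variable {k V W : Type*} [Field k] [Ring V] [Algebra k V] [AddCommGroup W] [Module k W]

/-- Let `π : V → W` be a surjective linear map from an algebra with further operations `Δ, ε, S`
onto a vector space with operations that `π` respects. Then `W` is a weak Hopf algebra as soon as
the axioms hold in `V` after applying `π` to every tensor factor of the values. -/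
theorem IsWeakHopfAlgebra.of_surjective (π : V →ₗ[k] W) (hπ : Function.Surjective π)
    {Δ : V →ₗ[k] V ⊗[k] V} {ε : V →ₗ[k] k} {S : V →ₗ[k] V}
    {mul : W →ₗ[k] W →ₗ[k] W} {Δ' : W →ₗ[k] W ⊗[k] W} {ε' : W →ₗ[k] k} {S' : W →ₗ[k] W}
    (map_mul : ∀ x y, mul (π x) (π y) = π (x * y))
    (map_comul : ∀ x, Δ' (π x) = TensorProduct.map π π (Δ x))
    (map_counit : ∀ x, ε' (π x) = ε x) (map_antipode : ∀ x, S' (π x) = π (S x))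
    (coassoc : ∀ x, sw (Δ x) (fun a b => sw (Δ a) fun c d => π c ⊗ₜ[k] (π d ⊗ₜ[k] π b)) =
      sw (Δ x) fun a b => sw (Δ b) fun c d => π a ⊗ₜ[k] (π c ⊗ₜ[k] π d))
    (counit_left : ∀ x, sw (Δ x) (fun a b => ε a • π b) = π x)
    (counit_right : ∀ x, sw (Δ x) (fun a b => ε b • π a) = π x)
    (comul_mul : ∀ x y, sw (Δ (x * y)) (fun a b => π a ⊗ₜ[k] π b) =
      sw (Δ x) fun a b => sw (Δ y) fun c d => π (a * c) ⊗ₜ[k] π (b * d))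
    (counit_mul_left : ∀ x y z, ε (x * y * z) = sw (Δ y) fun a b => ε (x * a) * ε (b * z))
    (counit_mul_right : ∀ x y z, ε (x * y * z) = sw (Δ y) fun a b => ε (a * z) * ε (x * b))
    (comul_one_left : sw (Δ 1) (fun a b => sw (Δ 1) fun c d =>
        π a ⊗ₜ[k] (π (c * b) ⊗ₜ[k] π d)) =
      sw (Δ 1) fun a b => sw (Δ b) fun c d => π a ⊗ₜ[k] (π c ⊗ₜ[k] π d))
    (comul_one_right : sw (Δ 1) (fun a b => sw (Δ 1) fun c d =>
        π a ⊗ₜ[k] (π (b * c) ⊗ₜ[k] π d)) =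
      sw (Δ 1) fun a b => sw (Δ b) fun c d => π a ⊗ₜ[k] (π c ⊗ₜ[k] π d))
    (mul_antipode : ∀ x, sw (Δ x) (fun a b => π (a * S b)) =
      sw (Δ 1) fun a b => ε (a * x) • π b)
    (antipode_mul : ∀ x, sw (Δ x) (fun a b => π (S a * b)) =
      sw (Δ 1) fun a b => ε (x * b) • π a)
    (antipode_mul_antipode : ∀ x, sw (Δ x) (fun a b => sw (Δ a) fun c d => π (S c * d * S b)) =
      π (S x)) :
    IsWeakHopfAlgebra mul (π 1) Δ' ε' S' where
  mul_assoc := by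
    refine hπ.forall₃.2 fun x y z => ?_
    simp only [map_mul, mul_assoc]
  one_mul := by
    refine hπ.forall.2 fun x => ?_
    rw [map_mul, one_mul]
  mul_one := by
    refine hπ.forall.2 fun x => ?_
    rw [map_mul, mul_one]
  coassoc := by
    refine hπ.forall.2 fun x => ?_
    apply eq_of_sw_sw_eq
    simpa (disch := fun_prop) only [sw_assoc, sw_rTensor, sw_lTensor, sw_tmul, map_comul,
      sw_map] using coassoc x
  counit_left := by
    refine hπ.forall.2 fun x => ?_
    simpa (disch := fun_prop) only [lid_eq_sw, sw_rTensor, map_comul, sw_map, map_counit] using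
      counit_left x
  counit_right := by
    refine hπ.forall.2 fun x => ?_
    simpa (disch := fun_prop) only [rid_eq_sw, sw_lTensor, map_comul, sw_map, map_counit] using
      counit_right x
  comul_mul := by
    refine hπ.forall₂.2 fun x y => ?_
    apply eq_of_sw_eq
    simpa (disch := fun_prop) only [map_mul, sw_map₂, map_comul, sw_map] using comul_mul x y
  counit_mul_left := by
    refine hπ.forall₃.2 fun x y z => ?_
    simpa (disch := fun_prop) only [map_mul, mul'_eq_sw, map_comul, sw_map, LinearMap.comp_apply,
      LinearMap.flip_apply, map_counit] using counit_mul_left x y z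
  counit_mul_right := by
    refine hπ.forall₃.2 fun x y z => ?_
    simpa (disch := fun_prop) only [map_mul, mul'_eq_sw, map_comul, sw_map, LinearMap.comp_apply,
      LinearMap.flip_apply, map_counit] using counit_mul_right x y z
  comul_one_left := by
    apply eq_of_sw_sw_eq
    rw [sw_map₂ _ _ _ _ _ (by fun_prop) (by fun_prop)]
    simpa (disch := fun_prop) only [sw_assoc, sw_lTensor, sw_tmul, sw_map₂, map_comul, sw_map,
      map_mul, one_mul, mul_one] using comul_one_left
  comul_one_right := by
    apply eq_of_sw_sw_eq
    rw [sw_map₂ _ _ _ _ _ (by fun_prop) (by fun_prop)]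
    simpa (disch := fun_prop) only [sw_assoc, sw_lTensor, sw_tmul, sw_map₂, map_comul, sw_map,
      map_mul, one_mul, mul_one] using comul_one_right
  mul_antipode := by
    refine hπ.forall.2 fun x => ?_
    simpa (disch := fun_prop) only [lift_eq_sw, sw_lTensor, map_comul, sw_map, map_mul,
      map_antipode, targetMap, lid_eq_sw, sw_rTensor, sw_map₂, sw_tmul,
      LinearMap.comp_apply, LinearEquiv.coe_coe, LinearMap.flip_apply, TensorProduct.mk_apply,
      map_counit, mul_one] using mul_antipode x
  antipode_mul := by
    refine hπ.forall.2 fun x => ?_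
    simpa (disch := fun_prop) only [lift_eq_sw, sw_lTensor, map_comul, sw_map, map_mul,
      map_antipode, sourceMap, rid_eq_sw, sw_rTensor, sw_map₂, sw_tmul,
      LinearMap.comp_apply, LinearEquiv.coe_coe, LinearMap.flip_apply, TensorProduct.mk_apply,
      map_counit, one_mul] using antipode_mul x
  antipode_mul_antipode := by
    refine hπ.forall.2 fun x => ?_
    rw [map_antipode, ← antipode_mul_antipode x]
    simp (disch := fun_prop) only [lift_eq_sw, map_comul, sw_map, LinearMap.comp_apply, sw_rTensor,
      map_antipode, map_mul]
    refine sw_congr _ fun a b => ?_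
    rw [Lin.map_sw (k := k) (G := fun u => mul u (π (S b))) (by fun_prop)]
    simp only [map_mul]

end Quotient

section Assembly

variable {k C H W : Type*} [Field k] [Ring C] [Algebra k C] [Coalgebra k C]
  [CommRing H] [Algebra k H] [Coalgebra k H] [AddCommGroup W] [Module k W]
  {ρ : C →ₗ[k] H ⊗[k] C} {SC : C →ₗ[k] C} {SH : H →ₗ[k] H}

/-- Every model `π : C ⊗ H → W`, with section `ι`, of the image of the multiplication by `E` is a
weak Hopf algebra. -/
theorem exists_isWeakHopfAlgebra_of_section (hC : IsAntipode SC) (hH : IsAntipode SH)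
    (hρ : IsComoduleBialgebra ρ) (π : C ⊗[k] H →ₗ[k] W) (ι : W →ₗ[k] C ⊗[k] H)
    (hπ : Function.Surjective π) (hπE : ∀ x, π (smashUnit ρ * x) = π x)
    (hι : ∀ x, ι (π x) = smashUnit ρ * x) :
    ∃ (mul : W →ₗ[k] W →ₗ[k] W) (Δ : W →ₗ[k] W ⊗[k] W) (ε : W →ₗ[k] k) (S : W →ₗ[k] W),
      IsWeakHopfAlgebra mul (π 1) Δ ε S ∧ (∀ x y, mul (π x) (π y) = π (x * y)) ∧
      (∀ x, Δ (π x) = TensorProduct.map π π (smashComul ρ x)) ∧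
      (∀ x, ε (π x) = smashCounit ρ x) ∧ ∀ x, S (π x) = π (smashAntipode ρ SC SH x) := by
  have hC' : IsWeakBialg k C := hC.toIsWeakBialgebra
  have hH' : IsWeakBialg k H := hH.toIsWeakBialgebra
  have hπE' (x y : C ⊗[k] H) : π (x * (smashUnit ρ * y)) = π (x * y) := by
    rw [← mul_assoc, ← smashUnit_mul_comm hH' hρ, mul_assoc, hπE]
  let mul := ((LinearMap.mul k (C ⊗[k] H)).compl₁₂ ι ι).compr₂ π
  let Δ := TensorProduct.map π π ∘ₗ smashComul ρ ∘ₗ ι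
  let ε := smashCounit ρ ∘ₗ ι
  let S := π ∘ₗ smashAntipode ρ SC SH ∘ₗ ι
  have hmul (x y : C ⊗[k] H) : mul (π x) (π y) = π (x * y) := by
    change π (ι (π x) * ι (π y)) = π (x * y)
    rw [hι, hι, mul_assoc, hπE, hπE']
  have hΔ (x : C ⊗[k] H) : Δ (π x) = TensorProduct.map π π (smashComul ρ x) := by
    change TensorProduct.map π π (smashComul ρ (ι (π x))) = _
    apply eq_of_sw_eq
    rw [hι]
    simp (disch := fun_prop) only [sw_map, sw_smashComul_smashUnit_mul hH' hρ, hπE]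
  have hε (x : C ⊗[k] H) : ε (π x) = smashCounit ρ x := by
    change smashCounit ρ (ι (π x)) = _
    rw [hι, smashCounit_apply, twist_smashUnit_mul hH' hρ, smashCounit_apply]
  have hS (x : C ⊗[k] H) : S (π x) = π (smashAntipode ρ SC SH x) := by
    change π (TensorProduct.map SC SH (twist ρ (ι (π x)))) = _
    rw [hι, twist_smashUnit_mul hH' hρ]
    rfl
  have hcounit (x y z : C ⊗[k] H) :
      smashCounit ρ (x * y * z) = tensorCounit (twist ρ x * twist ρ y * twist ρ z) • 1 := by
    rw [smashCounit_apply, twist_mul hρ, twist_mul hρ, smul_eq_mul, mul_one]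
  have hcounit' (x y : C ⊗[k] H) :
      smashCounit ρ (x * y) = tensorCounit (twist ρ x * twist ρ y) := by
    rw [smashCounit_apply, twist_mul hρ]
  refine ⟨mul, Δ, ε, S, ?_, hmul, hΔ, hε, hS⟩
  refine IsWeakHopfAlgebra.of_surjective π hπ hmul hΔ hε hS ?_ ?_ ?_ ?_ ?_ ?_
    ?_ ?_ ?_ ?_ ?_
  · exact fun x => sw_smashComul_coassoc hH' hρ x (fun a b c => π a ⊗ₜ[k] (π b ⊗ₜ[k] π c))
      (by fun_prop) (by fun_prop) (by fun_prop)
  · intro x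
    rw [sw_smashCounit_left hH' hρ x (fun a => π a) (by fun_prop), hπE]
  · exact fun x => sw_smashCounit_right hH' hρ x (fun a => π a) (by fun_prop) hπE
  · exact fun x y => sw_smashComul_mul hC' hH' hρ x y (fun a b => π a ⊗ₜ[k] π b) (by fun_prop)
      (by fun_prop)
  · intro x y z
    rw [hcounit, ← sw_tensorCounit_mul_left hC' hH' hρ]
    simp only [hcounit', smul_eq_mul, mul_one]
  · intro x y z
    rw [hcounit, ← sw_tensorCounit_mul_right hC' hH' hρ]
    simp only [hcounit', smul_eq_mul, mul_one]
    exact sw_congr _ fun a b => mul_comm _ _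
  · exact sw_smashComul_one_left hC' hH' hρ (fun a b c => π a ⊗ₜ[k] (π b ⊗ₜ[k] π c))
      (by fun_prop) (by fun_prop) (by fun_prop) (fun a b c => by simp only [hπE])
  · exact sw_smashComul_one_right hC' hH' hρ (fun a b c => π a ⊗ₜ[k] (π b ⊗ₜ[k] π c))
      (by fun_prop) (by fun_prop) (by fun_prop) (fun a b c => by simp only [hπE])
  · intro x
    rw [sw_mul_smashAntipode hC hH hρ x (fun a => π a) (by fun_prop) hπE]
    exact (sw_smashTarget hC' hH' hρ x (fun a => π a) (by fun_prop) hπE).symm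
  · intro x
    rw [sw_smashAntipode_mul hC hH hρ x (fun a => π a) (by fun_prop)]
    exact (sw_smashSource hC' hH hρ x (fun a => π a) (by fun_prop) hπE).symm
  · intro x
    rw [sw_smashComul_coassoc hH' hρ x (fun a b c => π (smashAntipode ρ SC SH a * b *
      smashAntipode ρ SC SH c)) (by fun_prop) (by fun_prop) (by fun_prop),
      ← sw_smashAntipode_mul_smashTarget hC hH hρ x (fun a => π a) (by fun_prop)]
    refine sw_congr _ fun a b => ?_
    simp only [mul_assoc]
    exact sw_mul_smashAntipode hC hH hρ b (fun u => π (smashAntipode ρ SC SH a * u))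
      (by fun_prop) (hπE' _)

end Assembly

end WeakHopf

end

theorem mainTheorem1 {k : Type*} {C : Type*} {H : Type*} [Field k]
    [Ring C] [Algebra k C] [Coalgebra k C]
    [CommRing H] [Algebra k H] [Coalgebra k H]
    (SC : C →ₗ[k] C) (hC : WeakHopf.IsAntipode SC)
    (SH : H →ₗ[k] H) (hH : WeakHopf.IsAntipode SH)
    (ρ : C →ₗ[k] H ⊗[k] C) (hρ : WeakHopf.IsComoduleBialgebra ρ) :
    ∃ (mul : WeakHopf.smash ρ →ₗ[k] WeakHopf.smash ρ →ₗ[k] WeakHopf.smash ρ)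
      (Δ : WeakHopf.smash ρ →ₗ[k] WeakHopf.smash ρ ⊗[k] WeakHopf.smash ρ)
      (ε : WeakHopf.smash ρ →ₗ[k] k)
      (S : WeakHopf.smash ρ →ₗ[k] WeakHopf.smash ρ),
      WeakHopf.IsWeakHopfAlgebra mul (WeakHopf.cross ρ 1 1) Δ ε S ∧
      (∀ (c b : C) (h l : H), mul (WeakHopf.cross ρ c h) (WeakHopf.cross ρ b l) =
        WeakHopf.cross ρ (c * b) (h * l)) ∧
      (∀ (c : C) (h : H), Δ (WeakHopf.cross ρ c h) =
        TensorProduct.map (WeakHopf.toSmash ρ) (WeakHopf.toSmash ρ)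
          (WeakHopf.smashComul ρ (c ⊗ₜ[k] h))) ∧
      (∀ (c : C) (h : H), ε (WeakHopf.cross ρ c h) = WeakHopf.smashCounit ρ (c ⊗ₜ[k] h)) ∧
      (∀ (c : C) (h : H), S (WeakHopf.cross ρ c h) =
        WeakHopf.toSmash ρ (WeakHopf.smashAntipode ρ SC SH (c ⊗ₜ[k] h))) := by
  have hH' : WeakHopf.IsWeakBialg k H := hH.toIsWeakBialgebra
  obtain ⟨mul, Δ, ε, S, hW, hmul, hΔ, hε, hS⟩ :=
    WeakHopf.exists_isWeakHopfAlgebra_of_section hC hH hρ (WeakHopf.toSmash ρ)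
      (WeakHopf.smash ρ).subtype (WeakHopf.toSmash_surjective ρ)
      (WeakHopf.toSmash_smashUnit_mul hH' hρ) (WeakHopf.smashMap_eq hH' hρ)
  refine ⟨mul, Δ, ε, S, hW, fun c b h l => ?_, fun c h => hΔ _, fun c h => hε _, fun c h => hS _⟩
  exact (hmul _ _).trans (by rw [Algebra.TensorProduct.tmul_mul_tmul]; rfl)
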